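/- **Notation.** Let $w(x)=1+|x|$, and for $1\le p\le\infty$, $s\in\mathbb R$ let $L^p_s(\mathbb R)=\{f: w^sf\in L^p(\mathbb R)\}$. For $1<p\le\infty$, a function $f$ on $\mathbb R$ belongs to the Hardy space $H^{p,+}$ if there is an analytic function $F$ on $\{\operatorname{Im}z>0\}$ with $\sup_{y>0}\|F(\cdot+iy)\|_{L^p}<\infty$ such that, as $y\searrow0$, $F(\cdot+iy)\to f$ both in the $L^p$ norm and almost everywhere. With $\hat f(\xi)=\int_{\mathbb R} e^{-i\xi x}f(x)\,dx$, let $C_+$ be the Cauchy projection $\widehat{C_+f}=\chi_{(0,\infty)}\hat f$, and let $$L_u\varphi=\tfrac1i\,\partial_x\varphi-C_+(u\varphi)$$ in the sense of tempered distributions. For $k\in\mathbb C\setminus[0,\infty)$ and $\lambda>0$ put $$G_k(x)=\frac1{2\pi}\int_0^\infty\frac{e^{ix\xi}}{\xi-k}\,d\xi,\qquad G_{\lambda\pm0i}(x)=\lim_{\epsilon\searrow0}G_{\lambda\pm i\epsilon}(x)=\pm ie^{i\lambda x}\chi_{\mathbb R^\pm}(x)-\frac1{2\pi}\int_{-\infty}^0\frac{e^{ix\xi}}{\xi-\lambda}\,d\xi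 .$$ **Lemma.** Let $p>1$ ($p=\infty$ allowed, with $1/\infty=0$), let $s>s_1>1-\frac1p$, and let $u\in L^p_s(\mathbb R)$ be real-valued. 1. If $\phi$ is an eigenfunction of $L_u$, regarded as an operator on $H^{2,+}$, for a negative eigenvalue $\lambda_j$ (that is, $0\ne\phi\in H^{2,+}$, $u\phi\in L^1(\mathbb R)$, and $L_u\phi=\lambda_j\phi$ with $\lambda_j<0$), then $\phi\in H^{\infty,+}$. 2. Let $k\in\mathbb C\setminus[0,\infty)$ or $k=\lambda\pm0i$ with $\lambda>0$, and let $m_1=m_1(\cdot,k)\in L^\infty_{-(s-s_1)}(\mathbb R)$ satisfy one of the following conditions: * (a) $L_um_1=k(m_1-1)$ (where $k$ is read as $\lambda$ if $k=\lambda\pm0i$), and $m_1(x)-1\to0$ as $|x|\to\infty$ if $k\in\mathbb C\setminus[0,\infty)$, respectively as $x\to\mp\infty$ if $k=\lambda\pm0i$; * (b) $m_1=1+G_k*(um_1)$. Then $m_1\in H^{\infty,+}$. 3. Let $\lambda>0$, and let $m_e=m_e(\cdot,\lambda\pm0i)\in L^\infty_{-(s-s_1)}(\mathbb R)$ satisfy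 one of the following conditions: * (a) $L_um_e=\lambda m_e$, and $m_e(x)-e^{i\lambda x}\to0$ as $x\to\mp\infty$; * (b) $m_e=e^{i\lambda x}+G_{\lambda\pm0i}*(um_e)$. Then $m_e\in H^{\infty,+}$. Upper signs, or lower signs, are to be taken throughout. Functions are identified when they agree almost everywhere; accordingly equations hold almost everywhere and limits at infinity are essential limits. -/

import Mathlib

open MeasureTheory Filter Topology
open scoped ENNReal NNReal SchwartzMap

namespace BenjaminOno

/-- The weight `w x = 1 + |x|`. -/
noncomputable def weight (x : ℝ) : ℝ := 1 + |x|

/-- Membership in the weighted space `L^p_s(ℝ)`, that is, `w ^ s • f ∈ L^p(ℝ)`. -/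
def MemWeightedLp {E : Type*} [NormedAddCommGroup E] [NormedSpace ℝ E]
    (p : ℝ≥0∞) (s : ℝ) (f : ℝ → E) : Prop :=
  MemLp (fun x => (weight x ^ s) • f x) p volume

/-- The Hardy space `H^{p,+}` of the upper half plane: `f` is the boundary value, in `L^p` and
almost everywhere, of an analytic function `F` on `{Im z > 0}` whose `L^p` norms on horizontal
lines are uniformly bounded. For `p = ∞` the function `F` is bounded and the convergence of
`F (· + i y)` to `f` as `y ↘ 0` is in the `L^∞` norm. -/
def MemHardy (p : ℝ≥0∞) (f : ℝ → ℂ) : Prop :=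
  MemLp f p volume ∧
  ∃ F : ℂ → ℂ,
    DifferentiableOn ℂ F {z : ℂ | 0 < z.im} ∧
    (∃ C : ℝ≥0, ∀ y : ℝ, 0 < y →
      eLpNorm (fun x : ℝ => F ((x : ℂ) + (y : ℂ) * Complex.I)) p volume ≤ (C : ℝ≥0∞)) ∧
    Tendsto
      (fun y : ℝ => eLpNorm (fun x : ℝ => F ((x : ℂ) + (y : ℂ) * Complex.I) - f x) p volume)
      (𝓝[>] (0 : ℝ)) (𝓝 0) ∧
    ∀ᵐ x : ℝ, Tendsto (fun y : ℝ => F ((x : ℂ) + (y : ℂ) * Complex.I))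
      (𝓝[>] (0 : ℝ)) (𝓝 (f x))

/-- The Fourier transform `∫ e^{-iξx} f(x) dx` of an integrable function. -/
noncomputable def fourierHat (f : ℝ → ℂ) (ξ : ℝ) : ℂ :=
  ∫ x : ℝ, Complex.exp (-(Complex.I * (ξ : ℂ) * (x : ℂ))) * f x

/-- The Cauchy projection `C₊ f` of an integrable function `f`, as a tempered distribution: its
Fourier transform is the bounded function `χ_{(0,∞)} · fourierHat f`. By Fourier inversion its
value at a test function `ψ` is `(2π)⁻¹ ∫_0^∞ (fourierHat f)(ξ) (fourierHat ψ)(-ξ) dξ`. -/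
noncomputable def cauchyPlus (f : ℝ → ℂ) (ψ : 𝓢(ℝ, ℂ)) : ℂ :=
  (1 / (2 * (Real.pi : ℂ))) *
    ∫ ξ in Set.Ioi (0 : ℝ), fourierHat f ξ * fourierHat (fun x => ψ x) (-ξ)

/-- `L_u φ = (1/i) φ_x - C₊(u φ)` as a tempered distribution, the derivative being the
distributional one: `⟨(1/i) φ_x, ψ⟩ = -(1/i) ∫ φ ψ' = i ∫ φ ψ'`. -/
noncomputable def laxL (u : ℝ → ℝ) (φ : ℝ → ℂ) (ψ : 𝓢(ℝ, ℂ)) : ℂ :=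
  Complex.I * (∫ x : ℝ, φ x * deriv (fun t => ψ t) x)
    - cauchyPlus (fun x => (u x : ℂ) * φ x) ψ

/-- The equation `L_u φ = g` in the sense of tempered distributions. -/
def SolvesLax (u : ℝ → ℝ) (φ g : ℝ → ℂ) : Prop :=
  ∀ ψ : 𝓢(ℝ, ℂ), laxL u φ ψ = ∫ x : ℝ, g x * ψ x

/-- `φ` is an eigenfunction, with eigenvalue `l`, of `L_u` regarded as an operator on `H^{2,+}`:
a nonzero element of `H^{2,+}` for which `L_u φ` is defined (`u φ` is integrable, which is
automatic when `u` is integrable and `φ ∈ H¹`, or when `u ∈ L²`) with `L_u φ = l φ`. -/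
def IsEigenfunction (u : ℝ → ℝ) (l : ℝ) (φ : ℝ → ℂ) : Prop :=
  MemHardy 2 φ ∧ ¬ (φ =ᵐ[volume] 0) ∧
    Integrable (fun x => (u x : ℂ) * φ x) volume ∧
    SolvesLax u φ (fun x => (l : ℂ) * φ x)

/-- The closed half line `[0, ∞)` in the complex plane. -/
def nonnegRay : Set ℂ := (fun t : ℝ => (t : ℂ)) '' Set.Ici 0

/-- The side from which the positive half line is approached: `above` stands for `l + 0i` and
`below` for `l - 0i`. -/
inductive Side
  | above
  | below

/-- The end of the real line at which the Jost functions at `l ± 0i` are normalised: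
`-∞` for `l + 0i` and `+∞` for `l - 0i`. -/
def Side.filter : Side → Filter ℝ
  | .above => atBot
  | .below => atTop

/-- The kernel `G_k(x) = (2π)⁻¹ ∫_0^∞ e^{ixξ} / (ξ - k) dξ`, an improper integral, which
converges for `x ≠ 0` and `k ∉ [0, ∞)`. -/
noncomputable def kernelG (k : ℂ) (x : ℝ) : ℂ :=
  (1 / (2 * (Real.pi : ℂ))) *
    limUnder atTop (fun R : ℝ =>
      ∫ ξ in (0 : ℝ)..R, Complex.exp (Complex.I * (x : ℂ) * (ξ : ℂ)) / ((ξ : ℂ) - k))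

/-- The kernel `(2π)⁻¹ ∫_{-∞}^0 e^{ixξ} / (ξ - k) dξ`, an improper integral, which
converges for `x ≠ 0` and `k ∉ (-∞, 0]`. -/
noncomputable def kernelGTilde (k : ℂ) (x : ℝ) : ℂ :=
  (1 / (2 * (Real.pi : ℂ))) *
    limUnder atTop (fun R : ℝ =>
      ∫ ξ in (-R)..(0 : ℝ), Complex.exp (Complex.I * (x : ℂ) * (ξ : ℂ)) / ((ξ : ℂ) - k))

/-- The boundary kernels `G_{l ± 0i}(x) = ± i e^{ilx} χ_{ℝ^±}(x) - kernelGTilde l x`, `l > 0`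
(the limits of `kernelG (l ± iε) x` as `ε ↘ 0`). -/
noncomputable def kernelGBdry (l : ℝ) : Side → ℝ → ℂ
  | .above => fun x =>
      (Set.Ioi (0 : ℝ)).indicator
        (fun t : ℝ => Complex.I * Complex.exp (Complex.I * (l : ℂ) * (t : ℂ))) x
        - kernelGTilde (l : ℂ) x
  | .below => fun x =>
      (Set.Iio (0 : ℝ)).indicator
        (fun t : ℝ => -(Complex.I * Complex.exp (Complex.I * (l : ℂ) * (t : ℂ)))) x
        - kernelGTilde (l : ℂ) x

/-- The convolution `G * (u m)`. -/
noncomputable def convU (G : ℝ → ℂ) (u : ℝ → ℝ) (m : ℝ → ℂ) (x : ℝ) : ℂ :=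
  ∫ y : ℝ, G (x - y) * ((u y : ℂ) * m y)

/-! Functions in weighted Lebesgue spaces are classes modulo null sets, so the limits at infinity
below are essential limits (along the infimum with the filter `ae volume`), and the integral
equations hold almost everywhere. -/

/-- Differential problem for the Jost function `m₁(·, k)`, `k ∉ [0, ∞)`. -/
def JostOneDiff (u : ℝ → ℝ) (k : ℂ) (m : ℝ → ℂ) : Prop :=
  SolvesLax u m (fun x => k * (m x - 1)) ∧
    Tendsto (fun x => m x - 1) (cocompact ℝ ⊓ ae volume) (𝓝 0)

/-- Integral equation for the Jost function `m₁(·, k)`, `k ∉ [0, ∞)`. -/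
def JostOneInt (u : ℝ → ℝ) (k : ℂ) (m : ℝ → ℂ) : Prop :=
  ∀ᵐ x : ℝ, m x = 1 + convU (kernelG k) u m x

/-- Differential problem for the Jost function `m₁(·, l ± 0i)`, `l > 0`. -/
def JostOneBdryDiff (u : ℝ → ℝ) (l : ℝ) (σ : Side) (m : ℝ → ℂ) : Prop :=
  SolvesLax u m (fun x => (l : ℂ) * (m x - 1)) ∧
    Tendsto (fun x => m x - 1) (σ.filter ⊓ ae volume) (𝓝 0)

/-- Integral equation for the Jost function `m₁(·, l ± 0i)`, `l > 0`. -/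
def JostOneBdryInt (u : ℝ → ℝ) (l : ℝ) (σ : Side) (m : ℝ → ℂ) : Prop :=
  ∀ᵐ x : ℝ, m x = 1 + convU (kernelGBdry l σ) u m x

/-- Differential problem for the Jost function `m_e(·, l ± 0i)`, `l > 0`. -/
def JostExpDiff (u : ℝ → ℝ) (l : ℝ) (σ : Side) (m : ℝ → ℂ) : Prop :=
  SolvesLax u m (fun x => (l : ℂ) * m x) ∧
    Tendsto (fun x : ℝ => m x - Complex.exp (Complex.I * (l : ℂ) * (x : ℂ)))
      (σ.filter ⊓ ae volume) (𝓝 0)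

/-- Integral equation for the Jost function `m_e(·, l ± 0i)`, `l > 0`. -/
def JostExpInt (u : ℝ → ℝ) (l : ℝ) (σ : Side) (m : ℝ → ℂ) : Prop :=
  ∀ᵐ x : ℝ, m x = Complex.exp (Complex.I * (l : ℂ) * (x : ℂ)) + convU (kernelGBdry l σ) u m x

end BenjaminOno

namespace BenjaminOno

/-! Write `g = u m`. The weights are chosen so that `g` lies in `L¹ ∩ L^q` for some `q > 1`, and
each function in the theorem equals `G * g` plus multiples of exponentials `e^{iωx}` with `ω ≥ 0`.
Such exponentials are bounded and analytic in the upper half plane, so everything rests on showing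
that `G * g` is the boundary value of a function that is analytic in the open half plane and bounded
and uniformly continuous on the closed one (`UniformHardy`). For `p = ∞` the norm convergence is
uniform convergence, which uniform continuity supplies.

For `k` off `[0, ∞)`, cut the frequency integral of `G_k` at `R`. The convolution becomes an
integral of `e^{ixξ}` against an integrable density over `0 ≤ ξ ≤ R`, which visibly extends to the
half plane. The cut kernels are bounded by multiples of `|x|^{-θ}` for each `0 < θ ≤ 1`, so they
converge in the dual exponent of `q`. By Hölder the convolutions converge uniformly on the line, and
by the maximum principle on the closed half plane (`exists_uniformHardy_kernelG_conv`).

At `l ± 0i` compare with the regular point `-l`: `f = G_{l+0i} * g` is bounded and solves `-i f' - l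
f = C₊ g`, while `V = G_{-l} * g` solves `-i V' + l V = C₊ g`. Hence `r = f - V` is a bounded
solution of `-i r' - l r = 2 l V`, and this equation can be integrated inside the half plane
(`exists_uniformHardy_of_ode`). The kernel for `l - 0i` changes the convolution only by a multiple
of `e^{ilx}`.

A solution of a differential problem differs from the corresponding convolution formula by some `c
e^{ikx}`. Off the ray, decay forces `c = 0`; for `k = l > 0` the extra term is harmless. For an
eigenfunction, `u φ` is initially known only to be in `L¹`; Young's inequality applied to `φ = G_l *
(u φ)` puts `φ` in every `L^Q`, `1 < Q < ∞`, and Hölder with `u ∈ L^q` then gives `u φ ∈ L^r` for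
some `r > 1`. -/

/-! ### Uniformly continuous boundary values and the maximum principle -/

/-- Analytic in the open upper half plane, bounded and uniformly continuous on the closed one. -/
structure UniformHardy (F : ℂ → ℂ) : Prop where
  differentiableOn : DifferentiableOn ℂ F {z : ℂ | 0 < z.im}
  uniformContinuousOn : UniformContinuousOn F {z : ℂ | 0 ≤ z.im}
  bounded : ∃ C : ℝ, ∀ z : ℂ, 0 ≤ z.im → ‖F z‖ ≤ C

theorem UniformHardy.exists_pos_bound {F : ℂ → ℂ} (hF : UniformHardy F) :
    ∃ C : ℝ, 0 < C ∧ ∀ z : ℂ, 0 ≤ z.im → ‖F z‖ ≤ C := by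
  obtain ⟨C, hC⟩ := hF.bounded
  exact ⟨max C 1, by positivity, fun z hz => (hC z hz).trans (le_max_left _ _)⟩

theorem UniformHardy.continuous_real {F : ℂ → ℂ} (hF : UniformHardy F) :
    Continuous fun x : ℝ => F x :=
  hF.uniformContinuousOn.continuousOn.comp_continuous Complex.continuous_ofReal (by simp)

/-- Uniform continuity up to the real line makes `F (x + iy) → F x` uniform in `x`, which is exactly
convergence in the `L^∞` norm. -/
theorem UniformHardy.memHardy_top {F : ℂ → ℂ} (hF : UniformHardy F) {f : ℝ → ℂ}
    (hf : ∀ᵐ x : ℝ, f x = F x) : MemHardy ⊤ f := by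
  obtain ⟨C, hC0, hC⟩ := hF.exists_pos_bound
  have hu := hF.uniformContinuousOn
  rw [Metric.uniformContinuousOn_iff] at hu
  have key : ∀ ε > 0, ∀ᶠ y : ℝ in 𝓝[>] (0 : ℝ), ∀ x : ℝ,
      ‖F ((x : ℂ) + (y : ℂ) * Complex.I) - F x‖ < ε := by
    intro ε hε
    obtain ⟨δ, hδ, h⟩ := hu ε hε
    filter_upwards [Ioo_mem_nhdsGT hδ] with y hy x
    rw [← dist_eq_norm]
    refine h _ (by simpa using hy.1.le) _ (by simp) ?_
    simpa [dist_eq_norm, abs_of_pos hy.1] using hy.2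
  refine ⟨?_, F, hF.differentiableOn, ⟨C.toNNReal, fun y hy => ?_⟩, ?_, ?_⟩
  · refine MemLp.ae_eq (f := fun x : ℝ => F x) (hf.mono fun x hx => hx.symm) ?_
    exact memLp_top_of_bound hF.continuous_real.aestronglyMeasurable C
      (ae_of_all _ fun x => hC _ (by simp))
  · rw [eLpNorm_exponent_top]
    refine eLpNormEssSup_le_of_ae_nnnorm_bound (ae_of_all _ fun x => ?_)
    rw [← NNReal.coe_le_coe, coe_nnnorm, Real.coe_toNNReal _ hC0.le]
    exact hC _ (by simpa using hy.le)
  · rw [ENNReal.tendsto_nhds_zero]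
    intro ε hε
    rcases eq_or_ne ε ⊤ with rfl | hε'
    · exact Eventually.of_forall fun _ => le_top
    filter_upwards [key ε.toReal (ENNReal.toReal_pos hε.ne' hε')] with y hy
    rw [eLpNorm_exponent_top]
    rw [← ENNReal.coe_toNNReal hε']
    refine eLpNormEssSup_le_of_ae_nnnorm_bound ?_
    filter_upwards [hf] with x hx
    rw [hx, ← NNReal.coe_le_coe, coe_nnnorm]
    exact (hy x).le
  · filter_upwards [hf] with x hx
    rw [hx, Metric.tendsto_nhds]
    intro ε hε
    filter_upwards [key ε hε] with y hy
    rw [dist_eq_norm]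
    exact hy x

theorem UniformHardy.add {F G : ℂ → ℂ} (hF : UniformHardy F) (hG : UniformHardy G) :
    UniformHardy fun z => F z + G z := by
  obtain ⟨C, hC⟩ := hF.bounded
  obtain ⟨D, hD⟩ := hG.bounded
  refine ⟨hF.1.add hG.1, ?_,
    C + D, fun z hz => (norm_add_le _ _).trans (add_le_add (hC z hz) (hD z hz))⟩
  exact uniformContinuousOn_iff_restrict.2 (UniformContinuous.add
    (uniformContinuousOn_iff_restrict.1 hF.2) (uniformContinuousOn_iff_restrict.1 hG.2))

theorem UniformHardy.const_mul {F : ℂ → ℂ} (hF : UniformHardy F) (c : ℂ) :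
    UniformHardy fun z => c * F z := by
  obtain ⟨C, hC⟩ := hF.bounded
  refine ⟨hF.1.const_mul c, ?_, ‖c‖ * C, fun z hz => ?_⟩
  · exact (uniformContinuous_const_smul c).comp_uniformContinuousOn hF.2
  · rw [norm_mul]
    gcongr
    exact hC z hz

theorem UniformHardy.sub {F G : ℂ → ℂ} (hF : UniformHardy F) (hG : UniformHardy G) :
    UniformHardy fun z => F z - G z := by
  simpa [sub_eq_add_neg] using hF.add (hG.const_mul (-1))

theorem uniformHardy_const (c : ℂ) : UniformHardy fun _ => c :=
  ⟨differentiableOn_const c, uniformContinuous_const.uniformContinuousOn, ‖c‖, fun _ _ => le_rfl⟩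

theorem convex_upperHalfPlane : Convex ℝ {z : ℂ | 0 < z.im} :=
  convex_halfSpace_im_gt 0

theorem isOpen_upperHalfPlane : IsOpen {z : ℂ | 0 < z.im} :=
  isOpen_lt continuous_const Complex.continuous_im

/-- A bounded analytic function with bounded derivative is of class `UniformHardy` as soon as it
has the right vertical limits at the real line. -/
theorem uniformHardy_of_deriv_bound {F F' : ℂ → ℂ} {C D : ℝ}
    (hd : ∀ z : ℂ, 0 < z.im → HasDerivAt F (F' z) z)
    (hb : ∀ z : ℂ, 0 < z.im → ‖F z‖ ≤ C) (hb' : ∀ z : ℂ, 0 < z.im → ‖F' z‖ ≤ D)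
    (hv : ∀ z : ℂ, 0 ≤ z.im →
      Tendsto (fun y : ℝ => F (z + (y : ℂ) * Complex.I)) (𝓝[>] 0) (𝓝 (F z))) :
    UniformHardy F := by
  have hmem : ∀ z : ℂ, 0 ≤ z.im → ∀ᶠ y : ℝ in 𝓝[>] (0 : ℝ),
      0 < (z + (y : ℂ) * Complex.I).im := by
    intro z hz
    filter_upwards [self_mem_nhdsWithin] with y (hy : 0 < y)
    simpa using by linarith
  -- The mean value inequality on the convex open half plane gives a Lipschitz bound there; the
  -- vertical limits carry it to the closed half plane.
  have hlip : ∀ z w : ℂ, 0 ≤ z.im → 0 ≤ w.im → ‖F z - F w‖ ≤ D * ‖z - w‖ := by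
    intro z w hz hw
    refine le_of_tendsto ((hv z hz).sub (hv w hw)).norm ?_
    filter_upwards [hmem z hz, hmem w hw] with y hy hy'
    have := convex_upperHalfPlane.norm_image_sub_le_of_norm_hasDerivWithin_le
      (fun x hx => (hd x hx).hasDerivWithinAt) (fun x hx => hb' x hx) hy' hy
    simpa using this
  refine ⟨fun z hz => (hd z hz).differentiableAt.differentiableWithinAt, ?_, C, fun z hz => ?_⟩
  · have hD : 0 ≤ D := (norm_nonneg _).trans (hb' Complex.I (by simp))
    refine (LipschitzOnWith.of_dist_le_mul (K := D.toNNReal) fun z hz w hw => ?_).uniformContinuousOn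
    rw [dist_eq_norm, dist_eq_norm, Real.coe_toNNReal _ hD]
    exact hlip z w hz hw
  · refine le_of_tendsto (hv z hz).norm ?_
    filter_upwards [hmem z hz] with y hy using hb _ hy

theorem norm_exp_I_mul (z : ℂ) (t : ℝ) :
    ‖Complex.exp (Complex.I * z * (t : ℂ))‖ = Real.exp (-(z.im * t)) := by
  rw [Complex.norm_exp]
  simp

theorem norm_exp_I_mul_le_one {z : ℂ} {t : ℝ} (hz : 0 ≤ z.im) (ht : 0 ≤ t) :
    ‖Complex.exp (Complex.I * z * (t : ℂ))‖ ≤ 1 := by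
  rw [norm_exp_I_mul, Real.exp_le_one_iff]
  have := mul_nonneg hz ht
  linarith

theorem uniformHardy_exp {l : ℝ} (hl : 0 ≤ l) :
    UniformHardy fun z => Complex.exp (Complex.I * (l : ℂ) * z) := by
  have hb : ∀ z : ℂ, 0 < z.im → ‖Complex.exp (Complex.I * (l : ℂ) * z)‖ ≤ 1 := by
    intro z hz
    rw [mul_right_comm]
    exact norm_exp_I_mul_le_one hz.le hl
  have hd : ∀ z : ℂ, HasDerivAt (fun z => Complex.exp (Complex.I * (l : ℂ) * z))
      (Complex.exp (Complex.I * (l : ℂ) * z) * (Complex.I * (l : ℂ))) z := by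
    intro z
    simpa using ((hasDerivAt_id z).const_mul (Complex.I * (l : ℂ))).cexp
  refine uniformHardy_of_deriv_bound (fun z _ => hd z) hb (D := l) (fun z hz => ?_) ?_
  · rw [norm_mul]
    have := hb z hz
    simp only [norm_mul, Complex.norm_I, Complex.norm_real, Real.norm_eq_abs, abs_of_nonneg hl,
      one_mul]
    nlinarith
  · intro z _
    have : Continuous fun y : ℝ => Complex.exp (Complex.I * (l : ℂ) * (z + (y : ℂ) * Complex.I)) := by
      fun_prop
    simpa using (this.tendsto 0).mono_left nhdsWithin_le_nhds

/-- The maximum principle: the supremum over the half plane is that over the real line. -/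
theorem UniformHardy.norm_le_of_real {F : ℂ → ℂ} (hF : UniformHardy F) {C : ℝ}
    (h : ∀ x : ℝ, ‖F x‖ ≤ C) {z : ℂ} (hz : 0 ≤ z.im) : ‖F z‖ ≤ C := by
  obtain ⟨B, hB⟩ := hF.bounded
  -- The rotation `w ↦ i w` takes the right half plane to the upper one, so that Phragmén–Lindelöf
  -- for the right half plane applies; the a priori bound `B` supplies its growth conditions.
  have hcl : closure {z : ℂ | 0 < z.re} = {z : ℂ | 0 ≤ z.re} := Complex.closure_setOfPred_lt_re 0
  have hI : ∀ w : ℂ, (Complex.I * w).im = w.re := fun w => by simp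
  have hd : DiffContOnCl ℂ (fun w => F (Complex.I * w)) {z : ℂ | 0 < z.re} := by
    refine ⟨hF.differentiableOn.comp ((differentiable_id.const_mul Complex.I).differentiableOn)
      fun w hw => by simpa using hw, ?_⟩
    rw [hcl]
    exact hF.uniformContinuousOn.continuousOn.comp (by fun_prop) fun w hw => by simpa using hw
  have := PhragmenLindelof.right_half_plane_of_bounded_on_real (C := C) hd
    ⟨1, by norm_num, 0, ?_⟩ ?_ ?_ (z := -Complex.I * z) (by simpa using hz)
  · simpa [← mul_assoc] using this
  · refine Asymptotics.IsBigO.of_bound B ?_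
    filter_upwards [mem_inf_of_right (mem_principal_self _)] with w hw
    simpa using hB (Complex.I * w) (by simpa using (le_of_lt hw))
  · refine ⟨B, ?_⟩
    rw [eventually_map]
    filter_upwards [eventually_ge_atTop 0] with x hx using hB _ (by simpa using hx)
  · intro x
    have : Complex.I * (x * Complex.I) = ((-x : ℝ) : ℂ) := by
      rw [mul_left_comm, Complex.I_mul_I]; simp
    simpa only [this] using h (-x)

/-- The maximum principle for differences turns uniform Cauchy convergence on the line into uniform
Cauchy convergence on the closed half plane, where analyticity, uniform continuity and boundedness
survive the limit. -/
theorem exists_uniformHardy_of_tendsto {f : ℝ → ℂ} {F : ℕ → ℂ → ℂ} (hF : ∀ n, UniformHardy (F n))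
    {e : ℕ → ℝ} (he : Tendsto e atTop (𝓝 0)) (h : ∀ n, ∀ x : ℝ, ‖F n x - f x‖ ≤ e n) :
    ∃ G, UniformHardy G ∧ ∀ x : ℝ, f x = G x := by
  have hc : UniformCauchySeqOn F atTop {z : ℂ | 0 ≤ z.im} := by
    rw [Metric.uniformCauchySeqOn_iff]
    intro ε hε
    obtain ⟨N, hN⟩ := eventually_atTop.1 (he.eventually (gt_mem_nhds (half_pos hε)))
    refine ⟨N, fun m hm n hn z hz => ?_⟩
    rw [dist_eq_norm]
    refine lt_of_le_of_lt (((hF m).sub (hF n)).norm_le_of_real (C := e m + e n) (fun x => ?_) hz) ?_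
    · calc ‖F m x - F n x‖ = ‖(F m x - f x) - (F n x - f x)‖ := by congr 1; ring
        _ ≤ _ := (norm_sub_le _ _).trans (add_le_add (h m x) (h n x))
    · linarith [hN m hm, hN n hn]
  have hlim : ∀ z : ℂ, ∃ w, 0 ≤ z.im → Tendsto (fun n => F n z) atTop (𝓝 w) := by
    intro z
    by_cases hz : 0 ≤ z.im
    · obtain ⟨w, hw⟩ := cauchySeq_tendsto_of_complete (hc.cauchySeq hz)
      exact ⟨w, fun _ => hw⟩
    · exact ⟨0, fun h => absurd h hz⟩
  choose G hG using hlim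
  have hu : TendstoUniformlyOn F G atTop {z : ℂ | 0 ≤ z.im} :=
    hc.tendstoUniformlyOn_of_tendsto fun z hz => hG z hz
  refine ⟨G, ⟨?_, hu.uniformContinuousOn
    (Eventually.of_forall fun n => (hF n).uniformContinuousOn).frequently, ?_⟩, fun x => ?_⟩
  · exact (hu.mono fun z (hz : 0 < z.im) => hz.le).tendstoLocallyUniformlyOn.differentiableOn
      (Eventually.of_forall fun n => (hF n).differentiableOn) isOpen_upperHalfPlane
  · rw [Metric.tendstoUniformlyOn_iff] at hu
    obtain ⟨n, hn⟩ := (hu 1 one_pos).exists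
    obtain ⟨C, hC⟩ := (hF n).bounded
    refine ⟨1 + C, fun z hz => ?_⟩
    calc ‖G z‖ = ‖(G z - F n z) + F n z‖ := by congr 1; ring
      _ ≤ _ := (norm_add_le _ _).trans (add_le_add (by simpa [dist_eq_norm] using (hn z hz).le) (hC z hz))
  · refine tendsto_nhds_unique ?_ (hG x (by simp))
    rw [tendsto_iff_norm_sub_tendsto_zero]
    exact squeeze_zero (fun _ => norm_nonneg _) (fun n => h n x) he

/-! ### The kernel off the ray and its frequency truncations -/

theorem isClosed_nonnegRay : IsClosed nonnegRay :=
  Complex.isometry_ofReal.isClosedEmbedding.isClosedMap _ isClosed_Ici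

theorem sub_ne_zero_of_notMem_nonnegRay {k : ℂ} (hk : k ∉ nonnegRay) {t : ℝ} (ht : 0 ≤ t) :
    (t : ℂ) - k ≠ 0 :=
  fun h => hk ⟨t, ht, sub_eq_zero.1 h⟩

/-- With `d` the positive distance from `k` to the ray, `1 + t ≤ ‖t - k‖ + (1 + ‖k‖)` and `1 + ‖k‖ ≤
((1 + ‖k‖) / d) ‖t - k‖`. -/
theorem exists_lower_bound_sub {k : ℂ} (hk : k ∉ nonnegRay) :
    ∃ c : ℝ, 0 < c ∧ ∀ t : ℝ, 0 ≤ t → c * (1 + t) ≤ ‖(t : ℂ) - k‖ := by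
  have hne : nonnegRay.Nonempty := ⟨_, 0, Set.self_mem_Ici, rfl⟩
  set d := Metric.infDist k nonnegRay with hd
  have hd0 : 0 < d := (isClosed_nonnegRay.notMem_iff_infDist_pos hne).1 hk
  have hn := norm_nonneg k
  refine ⟨(1 + (1 + ‖k‖) / d)⁻¹, by positivity, fun t ht => ?_⟩
  have h1 : d ≤ ‖(t : ℂ) - k‖ := by
    rw [← dist_eq_norm, dist_comm]
    exact Metric.infDist_le_dist_of_mem ⟨t, ht, rfl⟩
  have h2 : t ≤ ‖(t : ℂ) - k‖ + ‖k‖ := by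
    have := norm_add_le ((t : ℂ) - k) k
    simpa [abs_of_nonneg ht] using this
  rw [inv_mul_le_iff₀ (by positivity)]
  have h3 : 1 + ‖k‖ ≤ (1 + ‖k‖) / d * ‖(t : ℂ) - k‖ := by
    rw [div_mul_eq_mul_div, le_div_iff₀ hd0]
    gcongr
  linarith

theorem continuousOn_exp_div_sub {k : ℂ} (hk : k ∉ nonnegRay) (z : ℂ) {A R : ℝ} (hA : 0 ≤ A)
    (hR : 0 ≤ R) :
    ContinuousOn (fun t : ℝ => Complex.exp (Complex.I * z * (t : ℂ)) / ((t : ℂ) - k))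
      (Set.uIcc A R) := by
  refine ContinuousOn.div (by fun_prop) (by fun_prop) fun t ht => ?_
  exact sub_ne_zero_of_notMem_nonnegRay hk (le_trans (le_min hA hR) ht.1)

/-- One integration by parts gains `|x|⁻¹`. The two boundary terms contribute `2 / c`, and the
remaining integrand, of size `(1 + t)⁻²`, contributes `1 / c ^ 2`. -/
theorem exists_norm_integral_tail_le {k : ℂ} (hk : k ∉ nonnegRay) :
    ∃ D : ℝ, 0 < D ∧ ∀ A R x : ℝ, 0 ≤ A → A ≤ R → x ≠ 0 →
      ‖∫ t in A..R, Complex.exp (Complex.I * (x : ℂ) * (t : ℂ)) / ((t : ℂ) - k)‖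
        ≤ D * |x|⁻¹ * (1 + A)⁻¹ := by
  obtain ⟨c, hc, hck⟩ := exists_lower_bound_sub hk
  refine ⟨2 / c + 1 / c ^ 2, by positivity, fun A R x hA hAR hx => ?_⟩
  have hR := hA.trans hAR
  have hxC : Complex.I * (x : ℂ) ≠ 0 := mul_ne_zero Complex.I_ne_zero (by exact_mod_cast hx)
  have hu : Set.uIcc A R = Set.Icc A R := Set.uIcc_of_le hAR
  have hne : ∀ t ∈ Set.uIcc A R, (t : ℂ) - k ≠ 0 := fun t ht =>
    sub_ne_zero_of_notMem_nonnegRay hk (hA.trans (hu ▸ ht).1)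
  set H : ℝ → ℂ := fun t => Complex.exp (Complex.I * (x : ℂ) * (t : ℂ)) /
    (Complex.I * (x : ℂ) * ((t : ℂ) - k)) with hH
  set E : ℝ → ℂ := fun t => Complex.exp (Complex.I * (x : ℂ) * (t : ℂ)) /
    (Complex.I * (x : ℂ) * ((t : ℂ) - k) ^ 2) with hE
  have hder : ∀ t ∈ Set.uIcc A R, HasDerivAt H
      (Complex.exp (Complex.I * (x : ℂ) * (t : ℂ)) / ((t : ℂ) - k) - E t) t := by
    intro t ht
    have h1 : HasDerivAt (fun t : ℝ => Complex.exp (Complex.I * (x : ℂ) * (t : ℂ)))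
        (Complex.exp (Complex.I * (x : ℂ) * (t : ℂ)) * (Complex.I * (x : ℂ) * 1)) t :=
      ((Complex.ofRealCLM.hasDerivAt (x := t)).const_mul (Complex.I * (x : ℂ))).cexp
    have h2 : HasDerivAt (fun t : ℝ => Complex.I * (x : ℂ) * ((t : ℂ) - k))
        (Complex.I * (x : ℂ) * 1) t :=
      ((Complex.ofRealCLM.hasDerivAt (x := t)).sub_const k).const_mul _
    refine HasDerivAt.congr_deriv (h1.div h2 (mul_ne_zero hxC (hne t ht))) ?_
    have := hne t ht
    have hx' : (x : ℂ) ≠ 0 := by exact_mod_cast hx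
    simp only [hE]
    field_simp
  have hcont1 := continuousOn_exp_div_sub hk (x : ℂ) hA hR
  have hcontE : ContinuousOn E (Set.uIcc A R) :=
    ContinuousOn.div (by fun_prop) (by fun_prop) fun t ht =>
      mul_ne_zero hxC (pow_ne_zero _ (hne t ht))
  have hftc := intervalIntegral.integral_eq_sub_of_hasDerivAt hder
    (hcont1.intervalIntegrable.sub hcontE.intervalIntegrable)
  rw [intervalIntegral.integral_sub hcont1.intervalIntegrable hcontE.intervalIntegrable,
    sub_eq_iff_eq_add] at hftc
  rw [hftc]
  have hexp : ∀ t : ℝ, ‖Complex.exp (Complex.I * (x : ℂ) * (t : ℂ))‖ = 1 := by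
    intro t; rw [norm_exp_I_mul]; simp
  have hHb : ∀ t, 0 ≤ t → A ≤ t → ‖H t‖ ≤ |x|⁻¹ * c⁻¹ * (1 + A)⁻¹ := by
    intro t ht hAt
    simp only [hH, norm_div, hexp, norm_mul, Complex.norm_I, Complex.norm_real, Real.norm_eq_abs,
      one_mul, one_div]
    rw [mul_inv, mul_assoc, ← mul_inv c]
    have : c * (1 + A) ≤ ‖(t : ℂ) - k‖ := le_trans (by gcongr) (hck t ht)
    gcongr
  have hEb : ‖∫ t in A..R, E t‖ ≤ |x|⁻¹ * (c ^ 2)⁻¹ * (1 + A)⁻¹ := by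
    have hd : ∀ t ∈ Set.uIcc A R, HasDerivAt (fun t : ℝ => -(|x|⁻¹ * (c ^ 2)⁻¹ * (1 + t)⁻¹))
        (|x|⁻¹ * (c ^ 2)⁻¹ * ((1 + t) ^ 2)⁻¹) t := by
      intro t ht
      have h0 : 1 + t ≠ 0 := by have := hA.trans (hu ▸ ht).1; positivity
      have := (((hasDerivAt_id t).const_add 1).inv h0).const_mul (|x|⁻¹ * (c ^ 2)⁻¹)
      refine HasDerivAt.congr_deriv this.neg ?_
      simp [neg_div]
    have hci : ContinuousOn (fun t : ℝ => |x|⁻¹ * (c ^ 2)⁻¹ * ((1 + t) ^ 2)⁻¹) (Set.uIcc A R) := by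
      refine ContinuousOn.mul continuousOn_const (ContinuousOn.inv₀ (by fun_prop) fun t ht => ?_)
      have := hA.trans (hu ▸ ht).1
      positivity
    refine (intervalIntegral.norm_integral_le_of_norm_le hAR (ae_of_all _ fun t ht => ?_)
      hci.intervalIntegrable).trans ?_
    · have ht0 : 0 ≤ t := hA.trans ht.1.le
      simp only [hE, norm_div, hexp, norm_mul, Complex.norm_I, Complex.norm_real, Real.norm_eq_abs,
        one_mul, one_div, norm_pow]
      rw [mul_inv, mul_assoc, ← mul_inv (c ^ 2), ← mul_pow]
      gcongr
      exact hck t ht0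
    · rw [intervalIntegral.integral_eq_sub_of_hasDerivAt hd hci.intervalIntegrable]
      have : 0 ≤ |x|⁻¹ * (c ^ 2)⁻¹ * (1 + R)⁻¹ := by positivity
      linarith
  calc ‖H R - H A + ∫ t in A..R, E t‖
      ≤ (|x|⁻¹ * c⁻¹ * (1 + A)⁻¹ + |x|⁻¹ * c⁻¹ * (1 + A)⁻¹) + |x|⁻¹ * (c ^ 2)⁻¹ * (1 + A)⁻¹ :=
        (norm_add_le _ _).trans (add_le_add ((norm_sub_le _ _).trans
          (add_le_add (hHb R hR hAR) (hHb A hA le_rfl))) hEb)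
    _ = _ := by field_simp; ring

/-- The kernel `kernelG` with the frequency integral cut off at `R`. -/
noncomputable def kernelTrunc (k : ℂ) (R x : ℝ) : ℂ :=
  (1 / (2 * (Real.pi : ℂ))) *
    ∫ ξ in (0 : ℝ)..R, Complex.exp (Complex.I * (x : ℂ) * (ξ : ℂ)) / ((ξ : ℂ) - k)

theorem norm_one_div_two_pi_le_one : ‖1 / (2 * (Real.pi : ℂ))‖ ≤ 1 := by
  simp only [norm_div, norm_one, norm_mul, Complex.norm_real, Real.norm_eq_abs,
    abs_of_pos Real.pi_pos, Complex.norm_ofNat]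
  rw [div_le_one (by positivity)]
  linarith [Real.pi_gt_three]

/-- The tail bound makes the truncated integrals Cauchy, so the `limUnder` in `kernelG` is a genuine
limit and not a default value. -/
theorem tendsto_kernelTrunc {k : ℂ} (hk : k ∉ nonnegRay) {x : ℝ} (hx : x ≠ 0) :
    Tendsto (fun R => kernelTrunc k R x) atTop (𝓝 (kernelG k x)) := by
  obtain ⟨D, hD, h⟩ := exists_norm_integral_tail_le hk
  set J : ℝ → ℂ := fun R => ∫ ξ in (0 : ℝ)..R,
    Complex.exp (Complex.I * (x : ℂ) * (ξ : ℂ)) / ((ξ : ℂ) - k) with hJ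
  have hcauchy : ∀ ε > 0, ∃ N : ℝ, ∀ R ≥ N, dist (J R) (J N) < ε := by
    intro ε hε
    have ht : Tendsto (fun A : ℝ => D * |x|⁻¹ * (1 + A)⁻¹) atTop (𝓝 (D * |x|⁻¹ * 0)) :=
      (tendsto_inv_atTop_zero.comp (tendsto_atTop_add_const_left _ 1 tendsto_id)).const_mul _
    rw [mul_zero] at ht
    obtain ⟨N, hN, hN0⟩ := ((ht.eventually (gt_mem_nhds hε)).and (eventually_ge_atTop 0)).exists
    refine ⟨N, fun R hR => ?_⟩
    rw [dist_eq_norm, hJ]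
    simp only
    rw [intervalIntegral.integral_interval_sub_left
      (continuousOn_exp_div_sub hk _ le_rfl (hN0.trans hR)).intervalIntegrable
      (continuousOn_exp_div_sub hk _ le_rfl hN0).intervalIntegrable]
    exact (h N R x hN0 hR hx).trans_lt hN
  have hex : ∃ w, Tendsto J atTop (𝓝 w) := by
    refine cauchy_map_iff_exists_tendsto.1 (Metric.cauchy_iff.2 ⟨inferInstance, fun ε hε => ?_⟩)
    obtain ⟨N, hN⟩ := hcauchy (ε / 2) (half_pos hε)
    refine ⟨J '' Set.Ici N, image_mem_map (Ici_mem_atTop N), ?_⟩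
    rintro _ ⟨a, ha, rfl⟩ _ ⟨b, hb, rfl⟩
    calc dist (J a) (J b) ≤ dist (J a) (J N) + dist (J b) (J N) := dist_triangle_right _ _ _
      _ < ε := by linarith [hN a ha, hN b hb]
  exact (tendsto_nhds_limUnder hex).const_mul _

/-- Split the frequencies at `N = |x|⁻¹`. Below `N` use `(1 + t)⁻¹ ≤ t ^ (θ - 1)`; above it use the
tail bound and `N / (1 + N) ≤ min N 1 ≤ N ^ θ`. Small `θ` tames the singularity at `0`, and `θ = 1`
gives the decay at infinity. -/
theorem exists_kernelTrunc_le_rpow {k : ℂ} (hk : k ∉ nonnegRay) {θ : ℝ} (hθ : 0 < θ)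
    (hθ1 : θ ≤ 1) :
    ∃ C : ℝ, 0 < C ∧ ∀ R x : ℝ, 0 ≤ R → x ≠ 0 → ‖kernelTrunc k R x‖ ≤ C * |x| ^ (-θ) := by
  obtain ⟨D, hD, hT⟩ := exists_norm_integral_tail_le hk
  obtain ⟨c, hc, hck⟩ := exists_lower_bound_sub hk
  refine ⟨c⁻¹ * θ⁻¹ + D, by positivity, fun R x hR hx => ?_⟩
  have hx0 : 0 < |x| := abs_pos.2 hx
  set N := |x|⁻¹ with hN
  have hN0 : 0 < N := inv_pos.2 hx0
  have hNθ : |x| ^ (-θ) = N ^ θ := by rw [hN, Real.inv_rpow hx0.le, Real.rpow_neg hx0.le]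
  have hexp : ∀ t : ℝ, ‖Complex.exp (Complex.I * (x : ℂ) * (t : ℂ))‖ = 1 := by
    intro t; rw [norm_exp_I_mul]; simp
  have hlow : ∀ M, 0 ≤ M → M ≤ N →
      ‖∫ t in (0 : ℝ)..M, Complex.exp (Complex.I * (x : ℂ) * (t : ℂ)) / ((t : ℂ) - k)‖
        ≤ c⁻¹ * θ⁻¹ * N ^ θ := by
    intro M hM hMN
    have hint : IntervalIntegrable (fun t : ℝ => c⁻¹ * t ^ (θ - 1)) volume 0 M :=
      (intervalIntegral.intervalIntegrable_rpow' (by linarith)).const_mul _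
    refine (intervalIntegral.norm_integral_le_of_norm_le hM (ae_of_all _ fun t ht => ?_)
      hint).trans ?_
    · rw [norm_div, hexp, one_div]
      have h1 : ‖(t : ℂ) - k‖⁻¹ ≤ c⁻¹ * (1 + t)⁻¹ := by
        rw [← mul_inv]
        have := ht.1
        gcongr
        exact hck t ht.1.le
      refine h1.trans ?_
      gcongr
      have ht1 : 1 ≤ 1 + t := by linarith [ht.1]
      calc (1 + t)⁻¹ = (1 + t) ^ (-1 : ℝ) := by rw [Real.rpow_neg_one]
        _ ≤ (1 + t) ^ (θ - 1) := Real.rpow_le_rpow_of_exponent_le ht1 (by linarith)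
        _ ≤ t ^ (θ - 1) := Real.rpow_le_rpow_of_nonpos ht.1 (by linarith) (by linarith)
    · rw [intervalIntegral.integral_const_mul, integral_rpow (Or.inl (by linarith))]
      simp only [sub_add_cancel]
      rw [Real.zero_rpow hθ.ne', sub_zero, mul_assoc, div_eq_inv_mul]
      gcongr
  have hJ : ‖∫ t in (0 : ℝ)..R, Complex.exp (Complex.I * (x : ℂ) * (t : ℂ)) / ((t : ℂ) - k)‖
      ≤ (c⁻¹ * θ⁻¹ + D) * N ^ θ := by
    rcases le_total R N with h | h
    · refine (hlow R hR h).trans ?_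
      gcongr
      linarith
    · rw [← intervalIntegral.integral_add_adjacent_intervals
        (continuousOn_exp_div_sub hk _ le_rfl hN0.le).intervalIntegrable
        (continuousOn_exp_div_sub hk _ hN0.le hR).intervalIntegrable]
      refine (norm_add_le _ _).trans ?_
      rw [add_mul]
      refine add_le_add (hlow N hN0.le le_rfl) ((hT N R x hN0.le h hx).trans ?_)
      rw [mul_assoc]
      gcongr
      rcases le_total N 1 with h1 | h1
      · calc N * (1 + N)⁻¹ ≤ N * 1 := by gcongr; exact inv_le_one_of_one_le₀ (by linarith)
          _ = N ^ (1 : ℝ) := by simp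
          _ ≤ N ^ θ := Real.rpow_le_rpow_of_exponent_ge hN0 h1 hθ1
      · calc N * (1 + N)⁻¹ ≤ 1 := by
              rw [← div_eq_mul_inv, div_le_one (by positivity)]; linarith
          _ ≤ N ^ θ := Real.one_le_rpow h1 hθ.le
  rw [hNθ, kernelTrunc, norm_mul]
  calc _ ≤ 1 * _ := mul_le_mul_of_nonneg_right norm_one_div_two_pi_le_one (norm_nonneg _)
    _ ≤ _ := by rw [one_mul]; exact hJ

theorem continuous_kernelTrunc {k : ℂ} (hk : k ∉ nonnegRay) {R : ℝ} (hR : 0 ≤ R) :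
    Continuous (kernelTrunc k R) := by
  refine Continuous.mul continuous_const ?_
  obtain ⟨c, hc, hck⟩ := exists_lower_bound_sub hk
  have hi := (continuousOn_exp_div_sub hk 0 le_rfl hR).intervalIntegrable (μ := volume)
  refine intervalIntegral.continuous_of_dominated_interval
    (bound := fun t => ‖Complex.exp (Complex.I * 0 * (t : ℂ)) / ((t : ℂ) - k)‖) (fun x => ?_)
    (fun x => ae_of_all _ fun t _ => ?_) hi.norm (ae_of_all _ fun t _ => ?_)
  · exact (continuousOn_exp_div_sub hk (x : ℂ) le_rfl hR).intervalIntegrable.def'.aestronglyMeasurable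
  · rw [norm_div, norm_div, norm_exp_I_mul, norm_exp_I_mul]; simp
  · fun_prop

theorem aestronglyMeasurable_kernelG {k : ℂ} (hk : k ∉ nonnegRay) :
    AEStronglyMeasurable (kernelG k) volume := by
  refine aestronglyMeasurable_of_tendsto_ae (u := (atTop : Filter ℕ))
    (f := fun n : ℕ => kernelTrunc k (n : ℝ)) (fun n =>
    (continuous_kernelTrunc hk n.cast_nonneg).aestronglyMeasurable) ?_
  have : ∀ᵐ x : ℝ, x ≠ 0 := by simp [ae_iff]
  filter_upwards [this] with x hx
  exact (tendsto_kernelTrunc hk hx).comp tendsto_natCast_atTop_atTop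

theorem integrable_indicator_rpow {r : ℝ} (hr : r < 1) :
    Integrable ((Set.Icc (-1 : ℝ) 1).indicator fun x : ℝ => |x| ^ (-r)) := by
  rw [integrable_indicator_iff measurableSet_Icc]
  have hm : Measurable fun x : ℝ => |x| ^ (-r) := by fun_prop
  refine (locallyIntegrable_of_norm_le_rpow (C := 1) (α := r) (by simp) (by simpa using hr)
    (ae_of_all _ fun x => ?_) hm.aestronglyMeasurable).integrableOn_isCompact isCompact_Icc
  rw [one_mul, Real.norm_of_nonneg (by positivity), Real.norm_eq_abs]

/-- The truncated kernels have a common integrable plus bounded majorant. -/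
theorem exists_integrable_majorant {k : ℂ} (hk : k ∉ nonnegRay) :
    ∃ (B : ℝ → ℝ) (C : ℝ), (∀ x, 0 ≤ B x) ∧ 0 ≤ C ∧ Integrable B ∧
      ∀ R x : ℝ, 0 ≤ R → x ≠ 0 → ‖kernelTrunc k R x‖ ≤ B x + C := by
  -- The power `|x| ^ (-1/2)` is integrable near `0` and at most `1` outside `[-1, 1]`.
  obtain ⟨C, hC, h⟩ := exists_kernelTrunc_le_rpow hk (θ := 1 / 2) (by norm_num) (by norm_num)
  refine ⟨fun x => C * (Set.Icc (-1 : ℝ) 1).indicator (fun x : ℝ => |x| ^ (-(1 / 2 : ℝ))) x, C,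
    fun x => ?_, hC.le, (integrable_indicator_rpow (by norm_num)).const_mul C, fun R x hR hx => ?_⟩
  · exact mul_nonneg hC.le (Set.indicator_nonneg (fun x _ => by positivity) x)
  · refine (h R x hR hx).trans ?_
    dsimp only
    by_cases hx1 : x ∈ Set.Icc (-1 : ℝ) 1
    · rw [Set.indicator_of_mem hx1]; linarith
    · rw [Set.indicator_of_notMem hx1]
      have : 1 ≤ |x| := by
        by_contra hlt
        exact hx1 (abs_le.1 (not_le.1 hlt).le)
      have := Real.rpow_le_one_of_one_le_of_nonpos this (z := -(1 / 2)) (by norm_num)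
      nlinarith

theorem memLp_ofReal_of_integrable_rpow {f : ℝ → ℝ} (hf : AEStronglyMeasurable f volume)
    (h0 : ∀ x, 0 ≤ f x) {Q : ℝ} (hQ : 0 < Q) (h : Integrable fun x => f x ^ Q) :
    MemLp f (ENNReal.ofReal Q) := by
  rw [← integrable_norm_rpow_iff hf (by simpa using hQ) ENNReal.ofReal_ne_top,
    ENNReal.toReal_ofReal hQ.le]
  simpa only [Real.norm_of_nonneg (h0 _)] using h

/-- For `1 < Q < ∞` the truncated kernels have a common majorant in `L^Q`. -/
theorem exists_memLp_majorant {k : ℂ} (hk : k ∉ nonnegRay) {Q : ℝ} (hQ : 1 < Q) :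
    ∃ B : ℝ → ℝ, (∀ x, 0 ≤ B x) ∧ MemLp B (ENNReal.ofReal Q) ∧
      ∀ R x : ℝ, 0 ≤ R → x ≠ 0 → ‖kernelTrunc k R x‖ ≤ B x := by
  have hQ0 : 0 < Q := by linarith
  -- With `θ = 1 / (2 Q)` the `Q`-th power is `|x| ^ (-1/2)`, integrable near `0`; the bound with `θ
  -- = 1` below is used outside `[-1, 1]`, where `Q > 1` makes it `Q`-integrable.
  obtain ⟨C, hC, h⟩ := exists_kernelTrunc_le_rpow hk (θ := 1 / (2 * Q)) (by positivity)
    (by rw [div_le_one (by positivity)]; linarith)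
  obtain ⟨D, hD, h'⟩ := exists_kernelTrunc_le_rpow hk (θ := 1) one_pos le_rfl
  set B₁ : ℝ → ℝ := (Set.Icc (-1 : ℝ) 1).indicator fun x : ℝ => |x| ^ (-(1 / (2 * Q))) with hB₁
  set B₂ : ℝ → ℝ := fun x => (1 + ‖x‖) ^ (-1 : ℝ) with hB₂
  have hB₁0 : ∀ x, 0 ≤ B₁ x := fun x => Set.indicator_nonneg (fun x _ => by positivity) x
  have hB₂0 : ∀ x, 0 ≤ B₂ x := fun x => by positivity
  have hm₁ : MemLp B₁ (ENNReal.ofReal Q) := by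
    refine memLp_ofReal_of_integrable_rpow ?_ hB₁0 hQ0 ?_
    · have : Measurable fun x : ℝ => |x| ^ (-(1 / (2 * Q))) := by fun_prop
      exact (this.indicator measurableSet_Icc).aestronglyMeasurable
    · refine (integrable_indicator_rpow (r := 1 / 2) (by norm_num)).congr (ae_of_all _ fun x => ?_)
      by_cases hx : x ∈ Set.Icc (-1 : ℝ) 1
      · simp only [hB₁, Set.indicator_of_mem hx]
        rw [← Real.rpow_mul (abs_nonneg x)]
        congr 1
        field_simp
      · simp only [hB₁, Set.indicator_of_notMem hx]
        rw [Real.zero_rpow hQ0.ne']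
  have hm₂ : MemLp B₂ (ENNReal.ofReal Q) := by
    refine memLp_ofReal_of_integrable_rpow ?_ hB₂0 hQ0 ?_
    · have : Measurable B₂ := by fun_prop
      exact this.aestronglyMeasurable
    · have := integrable_one_add_norm (E := ℝ) (μ := volume) (r := Q) (by simpa using hQ)
      refine this.congr (ae_of_all _ fun x => ?_)
      simp only [hB₂]
      rw [← Real.rpow_mul (by positivity)]
      simp
  refine ⟨fun x => C * B₁ x + 2 * D * B₂ x, fun x => ?_,
    (hm₁.const_mul C).add (hm₂.const_mul (2 * D)), fun R x hR hx => ?_⟩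
  · have := hB₁0 x
    have := hB₂0 x
    positivity
  · by_cases hx1 : x ∈ Set.Icc (-1 : ℝ) 1
    · have h1 : B₁ x = |x| ^ (-(1 / (2 * Q))) := Set.indicator_of_mem hx1 _
      have := h R x hR hx
      rw [← h1] at this
      have := hB₂0 x
      have : 0 ≤ 2 * D * B₂ x := by positivity
      linarith
    · have h1 : 1 < |x| := by
        by_contra hlt
        exact hx1 (abs_le.1 (not_lt.1 hlt))
      have h2 : |x| ^ (-1 : ℝ) ≤ 2 * B₂ x := by
        simp only [hB₂, Real.rpow_neg_one, Real.norm_eq_abs]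
        rw [← div_eq_mul_inv, inv_eq_one_div, div_le_div_iff₀ (by positivity) (by positivity)]
        linarith
      have h3 := h' R x hR hx
      have h4 : 0 ≤ C * B₁ x := mul_nonneg hC.le (hB₁0 x)
      nlinarith

theorem norm_kernelG_le_of_majorant {k : ℂ} (hk : k ∉ nonnegRay) {B : ℝ → ℝ}
    (hB : ∀ R x : ℝ, 0 ≤ R → x ≠ 0 → ‖kernelTrunc k R x‖ ≤ B x) {x : ℝ} (hx : x ≠ 0) :
    ‖kernelG k x‖ ≤ B x :=
  le_of_tendsto (tendsto_kernelTrunc hk hx).norm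
    ((eventually_ge_atTop 0).mono fun R hR => hB R x hR hx)

theorem ae_ne_zero : ∀ᵐ x : ℝ, x ≠ 0 := by simp [ae_iff]

theorem memLp_kernelG {k : ℂ} (hk : k ∉ nonnegRay) {Q : ℝ} (hQ : 1 < Q) :
    MemLp (kernelG k) (ENNReal.ofReal Q) := by
  obtain ⟨B, hB0, hBL, hB⟩ := exists_memLp_majorant hk hQ
  refine hBL.mono (aestronglyMeasurable_kernelG hk) ?_
  filter_upwards [ae_ne_zero] with x hx
  rw [Real.norm_of_nonneg (hB0 x)]
  exact norm_kernelG_le_of_majorant hk hB hx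

theorem memLp_kernelTrunc {k : ℂ} (hk : k ∉ nonnegRay) {Q : ℝ} (hQ : 1 < Q) {R : ℝ} (hR : 0 ≤ R) :
    MemLp (kernelTrunc k R) (ENNReal.ofReal Q) := by
  obtain ⟨B, hB0, hBL, hB⟩ := exists_memLp_majorant hk hQ
  refine hBL.mono (continuous_kernelTrunc hk hR).aestronglyMeasurable ?_
  filter_upwards [ae_ne_zero] with x hx
  rw [Real.norm_of_nonneg (hB0 x)]
  exact hB R x hR hx

theorem tendsto_integral_kernelTrunc_sub {k : ℂ} (hk : k ∉ nonnegRay) {Q : ℝ} (hQ : 1 < Q) :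
    Tendsto (fun n : ℕ => ∫ x, ‖kernelTrunc k n x - kernelG k x‖ ^ Q) atTop (𝓝 0) := by
  obtain ⟨B, hB0, hBL, hB⟩ := exists_memLp_majorant hk hQ
  have hQ0 : 0 < Q := by linarith
  have hint : Integrable fun x => (2 * B x) ^ Q := by
    have := (hBL.const_mul 2).integrable_norm_rpow (by simpa using hQ0) ENNReal.ofReal_ne_top
    rw [ENNReal.toReal_ofReal hQ0.le] at this
    refine this.congr (ae_of_all _ fun x => ?_)
    have := hB0 x
    simp only
    rw [Real.norm_of_nonneg (by positivity)]
  have h0 : ∫ _ : ℝ, (0 : ℝ) = 0 := integral_zero _ _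
  rw [← h0]
  refine tendsto_integral_of_dominated_convergence _ (fun n => ?_) hint (fun n => ?_) ?_
  · exact (((continuous_kernelTrunc hk n.cast_nonneg).aestronglyMeasurable.sub
      (aestronglyMeasurable_kernelG hk)).norm.aemeasurable.pow_const Q).aestronglyMeasurable
  · filter_upwards [ae_ne_zero] with x hx
    rw [Real.norm_of_nonneg (by positivity)]
    refine Real.rpow_le_rpow (norm_nonneg _) ?_ hQ0.le
    have h1 := hB n x n.cast_nonneg hx
    have h2 := norm_kernelG_le_of_majorant hk hB hx
    have h3 := norm_sub_le (kernelTrunc k n x) (kernelG k x)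
    linarith
  · filter_upwards [ae_ne_zero] with x hx
    have h1 := (tendsto_kernelTrunc hk hx).comp tendsto_natCast_atTop_atTop
    have h2 := (tendsto_iff_norm_sub_tendsto_zero.1 h1).rpow_const (p := Q) (Or.inr hQ0.le)
    rwa [Real.zero_rpow hQ0.ne'] at h2

/-! ### Convolution with the kernel off the ray -/

theorem memLp_comp_sub_left {f : ℝ → ℂ} {p : ℝ≥0∞} (hf : MemLp f p) (x : ℝ) :
    MemLp (fun y => f (x - y)) p :=
  hf.comp_measurePreserving (Measure.measurePreserving_sub_left volume x)

theorem integrable_conv_of_holder {p q : ℝ} (hpq : p.HolderConjugate q) {K g : ℝ → ℂ}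
    (hK : MemLp K (ENNReal.ofReal p)) (hg : MemLp g (ENNReal.ofReal q)) (x : ℝ) :
    Integrable fun y => K (x - y) * g y := by
  have : ENNReal.HolderConjugate (ENNReal.ofReal p) (ENNReal.ofReal q) := hpq.ennrealOfReal
  exact (memLp_comp_sub_left hK x).integrable_mul hg

theorem norm_conv_le_of_holder {p q : ℝ} (hpq : p.HolderConjugate q) {K g : ℝ → ℂ}
    (hK : MemLp K (ENNReal.ofReal p)) (hg : MemLp g (ENNReal.ofReal q)) (x : ℝ) :
    ‖∫ y, K (x - y) * g y‖ ≤ (∫ y, ‖K y‖ ^ p) ^ (1 / p) * (∫ y, ‖g y‖ ^ q) ^ (1 / q) := by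
  refine (norm_integral_le_integral_norm _).trans ?_
  simp only [norm_mul]
  refine (integral_mul_norm_le_Lp_mul_Lq hpq (memLp_comp_sub_left hK x) hg).trans_eq ?_
  rw [integral_sub_left_eq_self (fun y => ‖K y‖ ^ p) volume x]

theorem norm_exp_neg_I_mul (ξ x : ℝ) : ‖Complex.exp (-(Complex.I * (ξ : ℂ) * (x : ℂ)))‖ = 1 := by
  rw [Complex.norm_exp]
  simp

theorem integrable_exp_neg_mul {g : ℝ → ℂ} (hg : Integrable g) (ξ : ℝ) :
    Integrable fun x : ℝ => Complex.exp (-(Complex.I * (ξ : ℂ) * (x : ℂ))) * g x :=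
  hg.bdd_mul (c := 1) (by fun_prop) (ae_of_all _ fun x => (norm_exp_neg_I_mul ξ x).le)

theorem norm_fourierHat_le (g : ℝ → ℂ) (ξ : ℝ) : ‖fourierHat g ξ‖ ≤ ∫ x, ‖g x‖ := by
  refine (norm_integral_le_integral_norm _).trans_eq ?_
  simp only [norm_mul, norm_exp_neg_I_mul, one_mul]

theorem continuous_fourierHat {g : ℝ → ℂ} (hg : Integrable g) : Continuous (fourierHat g) := by
  refine continuous_of_dominated (bound := fun x => ‖g x‖)
    (fun ξ => (integrable_exp_neg_mul hg ξ).aestronglyMeasurable)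
    (fun ξ => ae_of_all _ fun x => ?_) hg.norm (ae_of_all _ fun x => by fun_prop)
  rw [norm_mul, norm_exp_neg_I_mul, one_mul]

/-- Only nonnegative frequencies occur, so `|e^{izt}| ≤ 1` on the closed half plane; the cut at `R`
bounds the derivative as well. -/
theorem uniformHardy_integral_exp {h : ℝ → ℂ} {R : ℝ} (hR : 0 ≤ R)
    (hh : IntervalIntegrable h volume 0 R) :
    UniformHardy fun z => ∫ t in (0 : ℝ)..R, Complex.exp (Complex.I * z * (t : ℂ)) * h t := by
  have hΙ : ∀ t ∈ Set.uIoc 0 R, 0 ≤ t ∧ t ≤ R := fun t ht => by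
    rw [Set.uIoc_of_le hR] at ht
    exact ⟨ht.1.le, ht.2⟩
  have hmeas : ∀ z : ℂ, AEStronglyMeasurable
      (fun t : ℝ => Complex.exp (Complex.I * z * (t : ℂ)) * h t)
      (volume.restrict (Set.uIoc 0 R)) := fun z =>
    (Continuous.aestronglyMeasurable (by fun_prop)).mul hh.def'.aestronglyMeasurable
  have hbd : ∀ z : ℂ, 0 ≤ z.im → ∀ t ∈ Set.uIoc 0 R,
      ‖Complex.exp (Complex.I * z * (t : ℂ)) * h t‖ ≤ ‖h t‖ := fun z hz t ht => by
    rw [norm_mul]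
    exact mul_le_of_le_one_left (norm_nonneg _) (norm_exp_I_mul_le_one hz (hΙ t ht).1)
  have hbd' : ∀ z : ℂ, 0 ≤ z.im → ∀ t ∈ Set.uIoc 0 R,
      ‖Complex.exp (Complex.I * z * (t : ℂ)) * (Complex.I * t) * h t‖ ≤ R * ‖h t‖ :=
    fun z hz t ht => by
    rw [norm_mul, norm_mul, norm_mul, Complex.norm_I, one_mul, Complex.norm_real, Real.norm_eq_abs,
      abs_of_nonneg (hΙ t ht).1]
    have h1 := norm_exp_I_mul_le_one hz (hΙ t ht).1
    have h2 := norm_nonneg (Complex.exp (Complex.I * z * (t : ℂ)))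
    have := hΙ t ht
    gcongr
    nlinarith
  refine uniformHardy_of_deriv_bound (C := ∫ t in (0 : ℝ)..R, ‖h t‖)
    (F' := fun z => ∫ t in (0 : ℝ)..R,
      Complex.exp (Complex.I * z * (t : ℂ)) * (Complex.I * t) * h t)
    (D := ∫ t in (0 : ℝ)..R, R * ‖h t‖) (fun z hz => ?_) (fun z hz => ?_) (fun z hz => ?_)
    (fun z hz => ?_)
  · have hball : ∀ w ∈ Metric.ball z z.im, 0 ≤ w.im := fun w hw => by
      have h1 : |(w - z).im| ≤ ‖w - z‖ := Complex.abs_im_le_norm _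
      rw [Metric.mem_ball, dist_eq_norm] at hw
      have := (abs_le.1 h1).1
      simp only [Complex.sub_im] at this
      linarith
    refine (intervalIntegral.hasDerivAt_integral_of_dominated_loc_of_deriv_le
      (bound := fun t => R * ‖h t‖) (Metric.ball_mem_nhds z hz)
      (Eventually.of_forall fun w => hmeas w) (hh.mono_fun (hmeas z) ?_) ?_
      (ae_of_all _ fun t ht w hw => hbd' w (hball w hw) t ht) (hh.norm.const_mul R)
      (ae_of_all _ fun t ht w hw => ?_)).2
    · exact (ae_restrict_iff' measurableSet_uIoc).2 (ae_of_all _ fun t ht => hbd z hz.le t ht)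
    · exact (Continuous.aestronglyMeasurable (by fun_prop)).mul hh.def'.aestronglyMeasurable
    · refine HasDerivAt.mul_const ?_ _
      have : HasDerivAt (fun w : ℂ => Complex.I * w * (t : ℂ)) (Complex.I * t) w := by
        simpa using ((hasDerivAt_id w).const_mul Complex.I).mul_const (t : ℂ)
      exact this.cexp
  · exact intervalIntegral.norm_integral_le_of_norm_le hR
      (ae_of_all _ fun t ht => hbd z hz.le t (by rwa [Set.uIoc_of_le hR])) hh.norm
  · exact intervalIntegral.norm_integral_le_of_norm_le hR
      (ae_of_all _ fun t ht => hbd' z hz.le t (by rwa [Set.uIoc_of_le hR])) (hh.norm.const_mul R)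
  · refine intervalIntegral.tendsto_integral_filter_of_dominated_convergence (fun t => ‖h t‖)
      (Eventually.of_forall fun y => hmeas _) ?_ hh.norm (ae_of_all _ fun t ht => ?_)
    · filter_upwards [self_mem_nhdsWithin] with y (hy : 0 < y)
      exact ae_of_all _ fun t ht => hbd _ (by simpa using by linarith) t ht
    · have : Continuous fun y : ℝ =>
          Complex.exp (Complex.I * (z + (y : ℂ) * Complex.I) * (t : ℂ)) * h t := by fun_prop
      simpa using (this.tendsto 0).mono_left nhdsWithin_le_nhds

theorem integrable_kernelTrunc_conv {k : ℂ} (hk : k ∉ nonnegRay) {g : ℝ → ℂ} (hg : Integrable g)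
    {R : ℝ} (hR : 0 ≤ R) : Integrable (Function.uncurry fun (y t : ℝ) =>
      Complex.exp (-(Complex.I * (t : ℂ) * (y : ℂ))) * g y / ((t : ℂ) - k))
      (volume.prod (volume.restrict (Set.Ioc 0 R))) := by
  have hi := (continuousOn_exp_div_sub hk 0 le_rfl hR).intervalIntegrable (μ := volume)
  simp only [mul_zero, zero_mul, Complex.exp_zero] at hi
  rw [intervalIntegrable_iff_integrableOn_Ioc_of_le hR] at hi
  refine ((hg.mul_prod hi).bdd_mul (c := 1)
    (f := fun p : ℝ × ℝ => Complex.exp (-(Complex.I * (p.2 : ℂ) * (p.1 : ℂ))))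
    (Continuous.aestronglyMeasurable (by fun_prop))
    (ae_of_all _ fun p => (norm_exp_neg_I_mul p.2 p.1).le)).congr (ae_of_all _ fun p => ?_)
  simp only [Function.uncurry]
  ring

/-- Fubini exhibits the truncated convolution as a superposition of `e^{ixt}` with `0 ≤ t ≤ R`, the
form that extends analytically in `x`. -/
theorem kernelTrunc_conv_eq {k : ℂ} (hk : k ∉ nonnegRay) {g : ℝ → ℂ} (hg : Integrable g)
    {R : ℝ} (hR : 0 ≤ R) (x : ℝ) :
    ∫ y, kernelTrunc k R (x - y) * g y = ∫ t in (0 : ℝ)..R,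
      Complex.exp (Complex.I * (x : ℂ) * (t : ℂ)) *
        (1 / (2 * (Real.pi : ℂ)) * (fourierHat g t / ((t : ℂ) - k))) := by
  have hint : Integrable (Function.uncurry fun (y t : ℝ) => 1 / (2 * (Real.pi : ℂ)) *
      (Complex.exp (Complex.I * (x : ℂ) * (t : ℂ)) *
        (Complex.exp (-(Complex.I * (t : ℂ) * (y : ℂ))) * g y / ((t : ℂ) - k))))
      (volume.prod (volume.restrict (Set.Ioc 0 R))) := by
    refine ((integrable_kernelTrunc_conv hk hg hR).bdd_mul (c := 1)
      (f := fun p : ℝ × ℝ => Complex.exp (Complex.I * (x : ℂ) * (p.2 : ℂ)))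
      (Continuous.aestronglyMeasurable (by fun_prop))
      (ae_of_all _ fun p => ?_)).const_mul _
    rw [norm_exp_I_mul]
    simp
  calc ∫ y, kernelTrunc k R (x - y) * g y
      = ∫ y : ℝ, ∫ t in Set.Ioc 0 R, 1 / (2 * (Real.pi : ℂ)) *
        (Complex.exp (Complex.I * (x : ℂ) * (t : ℂ)) *
          (Complex.exp (-(Complex.I * (t : ℂ) * (y : ℂ))) * g y / ((t : ℂ) - k))) := by
        congr 1 with y
        rw [kernelTrunc, intervalIntegral.integral_of_le hR, integral_const_mul, mul_assoc,
          ← integral_mul_const]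
        congr 2 with t
        have : Complex.exp (Complex.I * ((x - y : ℝ) : ℂ) * (t : ℂ)) =
            Complex.exp (Complex.I * (x : ℂ) * (t : ℂ)) *
              Complex.exp (-(Complex.I * (t : ℂ) * (y : ℂ))) := by
          rw [← Complex.exp_add]; congr 1; push_cast; ring
        rw [this]
        ring
    _ = ∫ t in Set.Ioc 0 R, ∫ y : ℝ, 1 / (2 * (Real.pi : ℂ)) *
        (Complex.exp (Complex.I * (x : ℂ) * (t : ℂ)) *
          (Complex.exp (-(Complex.I * (t : ℂ) * (y : ℂ))) * g y / ((t : ℂ) - k))) :=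
        integral_integral_swap hint
    _ = _ := by
        rw [intervalIntegral.integral_of_le hR]
        congr 1 with t
        rw [integral_const_mul, integral_const_mul, integral_div, fourierHat]
        ring

theorem intervalIntegrable_fourierHat_div {k : ℂ} (hk : k ∉ nonnegRay) {g : ℝ → ℂ}
    (hg : Integrable g) {R : ℝ} (hR : 0 ≤ R) :
    IntervalIntegrable (fun t : ℝ => 1 / (2 * (Real.pi : ℂ)) * (fourierHat g t / ((t : ℂ) - k)))
      volume 0 R := by
  refine ContinuousOn.intervalIntegrable (continuousOn_const.mul
    ((continuous_fourierHat hg).continuousOn.div (by fun_prop) fun t ht => ?_))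
  rw [Set.uIcc_of_le hR] at ht
  exact sub_ne_zero_of_notMem_nonnegRay hk ht.1

/-- Convolution with `kernelG k` maps `L¹ ∩ L^q`, `1 < q < ∞`, into the boundary values of
`UniformHardy` functions. -/
theorem exists_uniformHardy_kernelG_conv {k : ℂ} (hk : k ∉ nonnegRay) {g : ℝ → ℂ}
    (hg : Integrable g) {q : ℝ} (hq : 1 < q) (hgq : MemLp g (ENNReal.ofReal q)) :
    ∃ G, UniformHardy G ∧ ∀ x : ℝ, ∫ y, kernelG k (x - y) * g y = G x := by
  have hpq := (Real.HolderConjugate.conjExponent hq).symm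
  set p := q.conjExponent
  -- The uniform error of the `n`-th approximation is, by Hölder, the `L^p` norm of the kernel
  -- difference times the `L^q` norm of `g`.
  have hlim := (tendsto_integral_kernelTrunc_sub hk hpq.lt).rpow_const (p := 1 / p)
    (Or.inr (one_div_nonneg.2 hpq.nonneg))
  rw [Real.zero_rpow (one_div_ne_zero hpq.ne_zero)] at hlim
  have hlim' := hlim.mul_const ((∫ y, ‖g y‖ ^ q) ^ (1 / q))
  rw [zero_mul] at hlim'
  refine exists_uniformHardy_of_tendsto (fun n : ℕ => uniformHardy_integral_exp n.cast_nonneg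
    (intervalIntegrable_fourierHat_div hk hg n.cast_nonneg)) hlim' fun n x => ?_
  have hT := memLp_kernelTrunc hk hpq.lt (n.cast_nonneg (α := ℝ))
  have hG := memLp_kernelG hk hpq.lt
  rw [← kernelTrunc_conv_eq hk hg n.cast_nonneg x,
    ← integral_sub (integrable_conv_of_holder hpq hT hgq x) (integrable_conv_of_holder hpq hG hgq x)]
  refine le_of_eq_of_le ?_ (norm_conv_le_of_holder hpq (hT.sub hG) hgq x)
  congr 2 with y
  simp [sub_mul]

/-! ### The homogeneous equation in the sense of distributions -/

theorem hasDerivAt_exp_I_mul (k : ℂ) (x : ℝ) :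
    HasDerivAt (fun t : ℝ => Complex.exp (Complex.I * k * (t : ℂ)))
      (Complex.exp (Complex.I * k * (x : ℂ)) * (Complex.I * k)) x := by
  simpa using ((Complex.ofRealCLM.hasDerivAt (x := x)).const_mul (Complex.I * k)).cexp

theorem contDiff_exp_I_mul (k : ℂ) :
    ContDiff ℝ (⊤ : ℕ∞) fun t : ℝ => Complex.exp (Complex.I * k * (t : ℂ)) :=
  (contDiff_const.mul Complex.ofRealCLM.contDiff).cexp

/-- A smooth compactly supported `f` with `∫ e^{ikx} f = 0` is `i ψ' - k ψ` for some smooth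
compactly supported `ψ`. -/
theorem exists_test_function {k : ℂ} {f : ℝ → ℂ} (hf : ContDiff ℝ (⊤ : ℕ∞) f)
    (hc : HasCompactSupport f)
    (h0 : ∫ x : ℝ, Complex.exp (Complex.I * k * (x : ℂ)) * f x = 0) :
    ∃ ψ : ℝ → ℂ, ContDiff ℝ (⊤ : ℕ∞) ψ ∧ HasCompactSupport ψ ∧
      ∀ x, Complex.I * deriv ψ x - k * ψ x = f x := by
  set G : ℝ → ℂ := fun x => Complex.exp (Complex.I * k * (x : ℂ)) * f x with hG
  have hGs : ContDiff ℝ (⊤ : ℕ∞) G := (contDiff_exp_I_mul k).mul hf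
  have hGc : HasCompactSupport G := hc.mul_left
  obtain ⟨M, hM0, hM⟩ := hGc.isCompact.isBounded.exists_pos_norm_le
  set N := M + 1
  have hGz : ∀ x, N ≤ |x| → G x = 0 := fun x hx =>
    image_eq_zero_of_notMem_tsupport fun hmem => by
      have := hM x hmem
      rw [Real.norm_eq_abs] at this
      linarith
  -- Conjugating by `e^{ikx}` reduces the equation to `P' = e^{ikx} f`, with `ψ = -i e^{-ikx} P`.
  -- The vanishing integral is what makes `P` zero to the right of the support.
  set P : ℝ → ℂ := fun x => ∫ t in (-N)..x, G t with hP
  have hPd : ∀ x, HasDerivAt P (G x) x := fun x =>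
    intervalIntegral.integral_hasDerivAt_right (hGs.continuous.intervalIntegrable _ _)
      hGs.continuous.stronglyMeasurable.stronglyMeasurableAtFilter hGs.continuous.continuousAt
  have hPs : ContDiff ℝ (⊤ : ℕ∞) P := by
    rw [contDiff_infty_iff_deriv]
    exact ⟨fun x => (hPd x).differentiableAt, by rwa [funext fun x => (hPd x).deriv]⟩
  have hPz : ∀ x, x ∉ Set.Icc (-N) N → P x = 0 := by
    intro x hx
    rcases lt_or_ge x (-N) with h | h
    · refine (intervalIntegral.integral_congr (g := fun _ => 0) fun t ht => ?_).trans (by simp)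
      rw [Set.uIcc_of_ge h.le] at ht
      exact hGz t (le_trans (by linarith [ht.2]) (neg_le_abs t))
    · have hxN : N < x := by
        by_contra hlt
        exact hx ⟨h, not_lt.1 hlt⟩
      rw [← h0, hP]
      simp only
      rw [intervalIntegral.integral_eq_integral_of_support_subset]
      intro t ht
      by_contra hnot
      refine ht ?_
      refine hGz t (not_lt.1 fun hta => hnot ?_)
      have hle := abs_lt.1 hta
      exact ⟨hle.1, hle.2.le.trans hxN.le⟩
  have hPc : HasCompactSupport P := HasCompactSupport.intro isCompact_Icc hPz
  refine ⟨fun x => -Complex.I * (Complex.exp (Complex.I * (-k) * (x : ℂ)) * P x),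
    contDiff_const.mul ((contDiff_exp_I_mul (-k)).mul hPs), (hPc.mul_left).mul_left, fun x => ?_⟩
  have hψ : HasDerivAt
      (fun x : ℝ => -Complex.I * (Complex.exp (Complex.I * (-k) * (x : ℂ)) * P x)) _ x :=
    ((hasDerivAt_exp_I_mul (-k) x).mul (hPd x)).const_mul (-Complex.I)
  rw [hψ.deriv]
  have hE : Complex.exp (Complex.I * -k * (x : ℂ)) * Complex.exp (Complex.I * k * (x : ℂ)) = 1 := by
    rw [← Complex.exp_add, ← Complex.exp_zero]; congr 1; ring
  simp only [hG]
  linear_combination f x * hE + (Complex.I * Complex.exp (Complex.I * -k * (x : ℂ)) * k * P x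
    - f x * Complex.exp (Complex.I * -k * (x : ℂ)) * Complex.exp (Complex.I * k * (x : ℂ))) *
      Complex.I_mul_I

/-- Locally integrable distributional solutions of `-i d' = k d` are multiples of `e^{ikx}`. -/
theorem exists_eq_const_mul_exp {k : ℂ} {d : ℝ → ℂ} (hd : LocallyIntegrable d)
    (h : ∀ ψ : ℝ → ℂ, ContDiff ℝ (⊤ : ℕ∞) ψ → HasCompactSupport ψ →
      ∫ x, d x * (Complex.I * deriv ψ x - k * ψ x) = 0) :
    ∃ c : ℂ, ∀ᵐ x : ℝ, d x = c * Complex.exp (Complex.I * k * (x : ℂ)) := by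
  let b : ContDiffBump (0 : ℝ) := ⟨1, 2, one_pos, one_lt_two⟩
  set β : ℝ → ℝ := b.normed volume with hβ
  have hβs : ContDiff ℝ (⊤ : ℕ∞) β := b.contDiff_normed
  have hβc : HasCompactSupport β := b.hasCompactSupport_normed
  -- `θ` is normalised by `∫ e^{ikx} θ = 1`, so for any test function `g` the difference `g - J θ`,
  -- `J = ∫ e^{ikx} g`, is of the form `i ψ' - k ψ` and is annihilated by `d`. This gives `∫ g d = J
  -- ∫ θ d` and identifies the constant.
  set θ : ℝ → ℂ := fun x => (β x : ℂ) * Complex.exp (Complex.I * (-k) * (x : ℂ)) with hθ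
  have hβs' : ContDiff ℝ (⊤ : ℕ∞) fun x => (β x : ℂ) := Complex.ofRealCLM.contDiff.comp hβs
  have hθs : ContDiff ℝ (⊤ : ℕ∞) θ := hβs'.mul (contDiff_exp_I_mul (-k))
  have hβc' : HasCompactSupport fun x => (β x : ℂ) := hβc.comp_left (g := Complex.ofReal) (by simp)
  have hθc : HasCompactSupport θ := hβc'.mul_right
  have hE : ∀ x : ℝ, Complex.exp (Complex.I * k * (x : ℂ)) *
      Complex.exp (Complex.I * -k * (x : ℂ)) = 1 := fun x => by
    rw [← Complex.exp_add, ← Complex.exp_zero]; congr 1; ring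
  have hθ1 : ∫ x : ℝ, Complex.exp (Complex.I * k * (x : ℂ)) * θ x = 1 := by
    have : ∀ x : ℝ, Complex.exp (Complex.I * k * (x : ℂ)) * θ x = (β x : ℂ) := fun x => by
      simp only [hθ]; linear_combination (β x : ℂ) * hE x
    simp only [this]
    rw [integral_complex_ofReal, b.integral_normed]; simp
  have hexpc : Continuous fun x : ℝ => Complex.exp (Complex.I * k * (x : ℂ)) :=
    (contDiff_exp_I_mul k).continuous
  have hint : ∀ f : ℝ → ℂ, Continuous f → HasCompactSupport f → Integrable fun x => f x * d x :=
    fun f hf hfc => by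
      simpa using hd.integrable_smul_left_of_hasCompactSupport hf hfc
  refine ⟨∫ x, θ x * d x, ae_eq_of_integral_contDiff_smul_eq hd
    (continuous_const.mul hexpc).locallyIntegrable fun g hg hgc => ?_⟩
  have hgs : ContDiff ℝ (⊤ : ℕ∞) fun x => (g x : ℂ) := Complex.ofRealCLM.contDiff.comp hg
  have hgc' : HasCompactSupport fun x => (g x : ℂ) := hgc.comp_left (g := Complex.ofReal) (by simp)
  set J : ℂ := ∫ x : ℝ, Complex.exp (Complex.I * k * (x : ℂ)) * (g x : ℂ) with hJ
  have hi1 : Integrable fun x : ℝ => Complex.exp (Complex.I * k * (x : ℂ)) * (g x : ℂ) :=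
    (hexpc.mul hgs.continuous).integrable_of_hasCompactSupport hgc'.mul_left
  have hi2 : Integrable fun x : ℝ => Complex.exp (Complex.I * k * (x : ℂ)) * θ x :=
    (hexpc.mul hθs.continuous).integrable_of_hasCompactSupport hθc.mul_left
  obtain ⟨ψ, hψs, hψc, hψ⟩ := exists_test_function (k := k) (f := fun x => (g x : ℂ) - J * θ x)
    (hgs.sub (contDiff_const.mul hθs)) (hgc'.sub hθc.mul_left) (by
      have : ∀ x : ℝ, Complex.exp (Complex.I * k * (x : ℂ)) * ((g x : ℂ) - J * θ x) =
          Complex.exp (Complex.I * k * (x : ℂ)) * (g x : ℂ) -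
            J * (Complex.exp (Complex.I * k * (x : ℂ)) * θ x) := fun x => by ring
      simp only [this]
      rw [integral_sub hi1 (hi2.const_mul J), integral_const_mul, hθ1, ← hJ]
      ring)
  have h0 := h ψ hψs hψc
  simp only [hψ] at h0
  have hsplit : ∀ x, d x * ((g x : ℂ) - J * θ x) = (g x : ℂ) * d x - J * (θ x * d x) :=
    fun x => by ring
  simp only [hsplit] at h0
  rw [integral_sub (hint _ hgs.continuous hgc') ((hint _ hθs.continuous hθc).const_mul J),
    integral_const_mul, sub_eq_zero] at h0
  simp only [Complex.real_smul]
  rw [h0, hJ, ← integral_mul_const]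
  congr 1 with x
  ring

/-! ### The equation satisfied by the convolution off the ray -/

/-- The transposed operator of `-i ∂ - k` applied to a test function. -/
noncomputable def testOp (k : ℂ) (ψ : 𝓢(ℝ, ℂ)) : 𝓢(ℝ, ℂ) :=
  Complex.I • SchwartzMap.derivCLM ℂ ℂ ψ - k • ψ

theorem testOp_apply (k : ℂ) (ψ : 𝓢(ℝ, ℂ)) (x : ℝ) :
    testOp k ψ x = Complex.I * deriv (fun t => ψ t) x - k * ψ x := by
  simp [testOp]

theorem schwartz_bounded (ψ : 𝓢(ℝ, ℂ)) : ∃ C : ℝ, 0 ≤ C ∧ ∀ x, ‖ψ x‖ ≤ C := by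
  refine ⟨‖ψ.toBoundedContinuousFunction‖, norm_nonneg _, fun x => ?_⟩
  exact ψ.toBoundedContinuousFunction.norm_coe_le_norm x

theorem ae_prod_sub {P : ℝ → Prop} (h : ∀ᵐ x, P x) :
    ∀ᵐ p : ℝ × ℝ ∂(volume.prod volume), P (p.1 - p.2) :=
  (quasiMeasurePreserving_sub_of_right_invariant volume volume).ae h

/-- The common dominating function for Fubini and for the passage to the limit in the kernel: the
`B` part is the integrand of a convolution of two `L¹` functions, the `C` part a product of
functions of separate variables. -/
theorem integrable_majorant_conv {B : ℝ → ℝ} (hB : Integrable B) (C : ℝ) {g : ℝ → ℂ}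
    (hg : Integrable g) (ψ : 𝓢(ℝ, ℂ)) :
    Integrable (fun p : ℝ × ℝ => (B (p.1 - p.2) + C) * ‖g p.2‖ * ‖ψ p.1‖)
      (volume.prod volume) := by
  obtain ⟨M, hM0, hM⟩ := schwartz_bounded ψ
  have h1 : Integrable (fun p : ℝ × ℝ => ‖ψ p.1‖ * (‖g p.2‖ * B (p.1 - p.2)))
      (volume.prod volume) :=
    (hg.norm.convolution_integrand (ContinuousLinearMap.mul ℝ ℝ) hB).bdd_mul (c := M)
      (Continuous.aestronglyMeasurable (by fun_prop))
      (ae_of_all _ fun p => by simpa using hM p.1)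
  have h2 : Integrable (fun p : ℝ × ℝ => ‖ψ p.1‖ * ‖g p.2‖) (volume.prod volume) :=
    ψ.integrable.norm.mul_prod hg.norm
  refine (h1.add (h2.const_mul C)).congr (ae_of_all _ fun p => ?_)
  simp only [Pi.add_apply]
  ring

theorem integrable_conv_mul {B : ℝ → ℝ} (hB : Integrable B) {C : ℝ} {K : ℝ → ℂ}
    (hK : AEStronglyMeasurable K volume) (hKB : ∀ᵐ x, ‖K x‖ ≤ B x + C) {g : ℝ → ℂ}
    (hg : Integrable g) (ψ : 𝓢(ℝ, ℂ)) :
    Integrable (fun p : ℝ × ℝ => K (p.1 - p.2) * g p.2 * ψ p.1) (volume.prod volume) := by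
  refine (integrable_majorant_conv hB C hg ψ).mono' ?_ ?_
  · refine AEStronglyMeasurable.mul ?_ (Continuous.aestronglyMeasurable (by fun_prop))
    refine (hg.aestronglyMeasurable.convolution_integrand (μ := volume) (ν := volume)
      (ContinuousLinearMap.mul ℝ ℂ) hK).congr (ae_of_all _ fun p => ?_)
    exact mul_comm _ _
  · filter_upwards [ae_prod_sub hKB] with p hp
    rw [norm_mul, norm_mul]
    gcongr

theorem integrable_conv_mul_test {B : ℝ → ℝ} (hB : Integrable B) {C : ℝ} {K : ℝ → ℂ}
    (hK : AEStronglyMeasurable K volume) (hKB : ∀ᵐ x, ‖K x‖ ≤ B x + C) {g : ℝ → ℂ}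
    (hg : Integrable g) (ψ : 𝓢(ℝ, ℂ)) :
    Integrable fun x => (∫ y, K (x - y) * g y) * ψ x := by
  refine (integrable_conv_mul hB hK hKB hg ψ).integral_prod_left.congr (ae_of_all _ fun x => ?_)
  exact integral_mul_const (ψ x) fun y => K (x - y) * g y

theorem integral_conv_mul_test {B : ℝ → ℝ} (hB : Integrable B) {C : ℝ} {K : ℝ → ℂ}
    (hK : AEStronglyMeasurable K volume) (hKB : ∀ᵐ x, ‖K x‖ ≤ B x + C) {g : ℝ → ℂ}
    (hg : Integrable g) (ψ : 𝓢(ℝ, ℂ)) :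
    ∫ x, (∫ y, K (x - y) * g y) * ψ x =
      ∫ p : ℝ × ℝ, K (p.1 - p.2) * g p.2 * ψ p.1 ∂(volume.prod volume) := by
  rw [integral_prod _ (integrable_conv_mul hB hK hKB hg ψ)]
  congr 1 with x
  exact (integral_mul_const _ _).symm

theorem aestronglyMeasurable_conv {K g : ℝ → ℂ} (hK : AEStronglyMeasurable K volume)
    (hg : AEStronglyMeasurable g volume) :
    AEStronglyMeasurable (fun x => ∫ y, K (x - y) * g y) volume := by
  have h : AEStronglyMeasurable (fun p : ℝ × ℝ => K (p.1 - p.2) * g p.2) (volume.prod volume) :=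
    (hg.convolution_integrand (μ := volume) (ν := volume)
      (ContinuousLinearMap.mul ℝ ℂ) hK).congr (ae_of_all _ fun p => mul_comm _ _)
  exact h.integral_prod_right'

/-- The convolution of `g ∈ L¹` with an `L¹ + L^∞` kernel is locally integrable. -/
theorem locallyIntegrable_conv {B : ℝ → ℝ} (hB : Integrable B) {C : ℝ} {K : ℝ → ℂ}
    (hK : AEStronglyMeasurable K volume) (hKB : ∀ᵐ x, ‖K x‖ ≤ B x + C) {g : ℝ → ℂ}
    (hg : Integrable g) : LocallyIntegrable fun x => ∫ y, K (x - y) * g y := by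
  refine locallyIntegrable_iff.2 fun S hS => ?_
  obtain ⟨N, hN0, hN⟩ := hS.isBounded.exists_pos_norm_le
  -- A cutoff equal to `1` on the compact set `S`: integrability against it is integrability on `S`.
  let b : ContDiffBump (0 : ℝ) := ⟨N, N + 1, hN0, by linarith⟩
  have hbc : HasCompactSupport fun x => (b x : ℂ) :=
    b.hasCompactSupport.comp_left (g := Complex.ofReal) (by simp)
  have hbs : ContDiff ℝ (⊤ : ℕ∞) fun x => (b x : ℂ) := Complex.ofRealCLM.contDiff.comp b.contDiff
  have := (integrable_conv_mul_test hB hK hKB hg (hbc.toSchwartzMap hbs)).integrableOn (s := S)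
  refine this.congr_fun (fun x hx => ?_) hS.measurableSet
  have h1 : b x = 1 := b.one_of_mem_closedBall (by simpa using hN x hx)
  simp [h1]

/-- The normalisation `e^{-2πixξ}` of `FourierTransform.fourier` accounts for the rescaling by `2π`.
-/
theorem fourierHat_eq_fourier (f : ℝ → ℂ) (ξ : ℝ) :
    fourierHat f ξ = FourierTransform.fourier f (ξ / (2 * Real.pi)) := by
  rw [fourierHat, Real.fourier_real_eq_integral_exp_smul]
  congr 1 with x
  rw [smul_eq_mul]
  congr 2
  have : (Real.pi : ℂ) ≠ 0 := by exact_mod_cast Real.pi_ne_zero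
  push_cast
  field_simp

theorem integrable_fourierHat_schwartz (ψ : 𝓢(ℝ, ℂ)) : Integrable (fourierHat fun x => ψ x) := by
  have h : Integrable (fun x => (FourierTransform.fourier ψ : 𝓢(ℝ, ℂ)) x) :=
    SchwartzMap.integrable _
  have h2 := h.comp_div (R := 2 * Real.pi) (by positivity)
  refine h2.congr (ae_of_all _ fun ξ => ?_)
  simp only [fourierHat_eq_fourier]
  rfl

theorem integrable_fourierHat_mul {g : ℝ → ℂ} (hg : Integrable g) (ψ : 𝓢(ℝ, ℂ)) :
    Integrable fun ξ => fourierHat g ξ * fourierHat (fun x => ψ x) (-ξ) :=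
  (integrable_fourierHat_schwartz ψ).comp_neg.bdd_mul (c := ∫ x, ‖g x‖)
    (continuous_fourierHat hg).aestronglyMeasurable (ae_of_all _ fun ξ => norm_fourierHat_le g ξ)

theorem fourierHat_neg_eq (ψ : 𝓢(ℝ, ℂ)) (t : ℝ) : fourierHat (fun x => ψ x) (-t) =
    ∫ x : ℝ, Complex.exp (Complex.I * (t : ℂ) * (x : ℂ)) * ψ x := by
  rw [fourierHat]
  congr 1 with x
  congr 2
  push_cast
  ring

theorem integrable_exp_mul_schwartz (ψ : 𝓢(ℝ, ℂ)) (t : ℝ) :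
    Integrable fun x : ℝ => Complex.exp (Complex.I * (t : ℂ) * (x : ℂ)) * ψ x :=
  ψ.integrable.bdd_mul (c := 1) (by fun_prop) (ae_of_all _ fun x => by
    rw [norm_exp_I_mul]; simp)

theorem integral_exp_mul_deriv (ψ : 𝓢(ℝ, ℂ)) (t : ℝ) :
    ∫ x : ℝ, Complex.exp (Complex.I * (t : ℂ) * (x : ℂ)) * deriv (fun t => ψ t) x =
      -(Complex.I * t) * ∫ x : ℝ, Complex.exp (Complex.I * (t : ℂ) * (x : ℂ)) * ψ x := by
  have hi := integrable_exp_mul_schwartz ψ t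
  have hi' := integrable_exp_mul_schwartz (SchwartzMap.derivCLM ℂ ℂ ψ) t
  simp only [SchwartzMap.derivCLM_apply] at hi'
  have h := integral_eq_zero_of_hasDerivAt_of_integrable
    (f := fun x : ℝ => Complex.exp (Complex.I * (t : ℂ) * (x : ℂ)) * ψ x)
    (f' := fun x : ℝ => (Complex.I * t) * (Complex.exp (Complex.I * (t : ℂ) * (x : ℂ)) * ψ x) +
      Complex.exp (Complex.I * (t : ℂ) * (x : ℂ)) * deriv (fun t => ψ t) x)
    (fun x => ((hasDerivAt_exp_I_mul t x).mul ψ.differentiableAt.hasDerivAt).congr_deriv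
      (by ring)) ((hi.const_mul _).add hi') hi
  rw [integral_add (hi.const_mul _) hi', integral_const_mul] at h
  linear_combination h

/-- On `e^{itx}` the operator `-i ∂ - k` is multiplication by `t - k`, the factor that cancels the
denominator of the kernel. -/
theorem integral_exp_mul_testOp (k : ℂ) (ψ : 𝓢(ℝ, ℂ)) (t : ℝ) :
    ∫ x : ℝ, Complex.exp (Complex.I * (t : ℂ) * (x : ℂ)) * testOp k ψ x =
      ((t : ℂ) - k) * fourierHat (fun x => ψ x) (-t) := by
  have hi := integrable_exp_mul_schwartz ψ t
  have hi' := integrable_exp_mul_schwartz (SchwartzMap.derivCLM ℂ ℂ ψ) t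
  simp only [SchwartzMap.derivCLM_apply] at hi'
  have : ∀ x : ℝ, Complex.exp (Complex.I * (t : ℂ) * (x : ℂ)) * testOp k ψ x =
      Complex.I * (Complex.exp (Complex.I * (t : ℂ) * (x : ℂ)) * deriv (fun t => ψ t) x) -
        k * (Complex.exp (Complex.I * (t : ℂ) * (x : ℂ)) * ψ x) := fun x => by
    rw [testOp_apply]; ring
  simp only [this]
  rw [integral_sub (hi'.const_mul _) (hi.const_mul _), integral_const_mul, integral_const_mul,
    integral_exp_mul_deriv, fourierHat_neg_eq]
  linear_combination (-(t : ℂ) * ∫ x : ℝ, Complex.exp (Complex.I * (t : ℂ) * (x : ℂ)) * ψ x) *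
    Complex.I_mul_I

theorem integral_kernelTrunc_conv_testOp {k : ℂ} (hk : k ∉ nonnegRay) {g : ℝ → ℂ}
    (hg : Integrable g) {R : ℝ} (hR : 0 ≤ R) (ψ : 𝓢(ℝ, ℂ)) :
    ∫ x, (∫ y, kernelTrunc k R (x - y) * g y) * testOp k ψ x =
      1 / (2 * (Real.pi : ℂ)) *
        ∫ ξ in (0 : ℝ)..R, fourierHat g ξ * fourierHat (fun x => ψ x) (-ξ) := by
  simp only [kernelTrunc_conv_eq hk hg hR, intervalIntegral.integral_of_le hR]
  set h : ℝ → ℂ := fun t => 1 / (2 * (Real.pi : ℂ)) * (fourierHat g t / ((t : ℂ) - k)) with hh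
  have hh1 : Integrable h (volume.restrict (Set.Ioc 0 R)) :=
    (intervalIntegrable_iff_integrableOn_Ioc_of_le hR).1
      (intervalIntegrable_fourierHat_div hk hg hR)
  have hint : Integrable (Function.uncurry fun (x t : ℝ) =>
      Complex.exp (Complex.I * (x : ℂ) * (t : ℂ)) * h t * testOp k ψ x)
      (volume.prod (volume.restrict (Set.Ioc 0 R))) := by
    refine (((testOp k ψ).integrable.mul_prod hh1).bdd_mul (c := 1)
      (f := fun p : ℝ × ℝ => Complex.exp (Complex.I * (p.1 : ℂ) * (p.2 : ℂ)))
      (Continuous.aestronglyMeasurable (by fun_prop))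
      (ae_of_all _ fun p => by rw [norm_exp_I_mul]; simp)).congr (ae_of_all _ fun p => ?_)
    simp only [Function.uncurry]
    ring
  calc _ = ∫ x : ℝ, ∫ t in Set.Ioc 0 R,
        Complex.exp (Complex.I * (x : ℂ) * (t : ℂ)) * h t * testOp k ψ x := by
        congr 1 with x
        rw [integral_mul_const]
    _ = ∫ t in Set.Ioc 0 R, ∫ x : ℝ,
        Complex.exp (Complex.I * (x : ℂ) * (t : ℂ)) * h t * testOp k ψ x :=
        integral_integral_swap hint
    _ = ∫ t in Set.Ioc 0 R, 1 / (2 * (Real.pi : ℂ)) *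
        (fourierHat g t * fourierHat (fun x => ψ x) (-t)) := by
        refine setIntegral_congr_fun measurableSet_Ioc fun t ht => ?_
        have hne := sub_ne_zero_of_notMem_nonnegRay hk ht.1.le
        have : ∀ x : ℝ, Complex.exp (Complex.I * (x : ℂ) * (t : ℂ)) * h t * testOp k ψ x =
            h t * (Complex.exp (Complex.I * (t : ℂ) * (x : ℂ)) * testOp k ψ x) := fun x => by
          rw [mul_right_comm Complex.I]; ring
        simp only [this]
        rw [integral_const_mul, integral_exp_mul_testOp]
        simp only [hh]
        field_simp
    _ = _ := integral_const_mul _ _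

theorem norm_kernelG_le_majorant {k : ℂ} (hk : k ∉ nonnegRay) :
    ∃ (B : ℝ → ℝ) (C : ℝ), Integrable B ∧ ∀ᵐ x, ‖kernelG k x‖ ≤ B x + C := by
  obtain ⟨B, C, -, -, hB, h⟩ := exists_integrable_majorant hk
  exact ⟨B, C, hB, ae_ne_zero.mono fun x hx =>
    norm_kernelG_le_of_majorant hk (B := fun x => B x + C) h hx⟩

/-- For `g ∈ L¹`, `G_k * g` solves `-i f' - k f = C₊ g`. -/
theorem integral_kernelG_conv_testOp {k : ℂ} (hk : k ∉ nonnegRay) {g : ℝ → ℂ}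
    (hg : Integrable g) (ψ : 𝓢(ℝ, ℂ)) :
    ∫ x, (∫ y, kernelG k (x - y) * g y) * testOp k ψ x = cauchyPlus g ψ := by
  obtain ⟨B, C, hB0, hC0, hB, h⟩ := exists_integrable_majorant hk
  have hGm := aestronglyMeasurable_kernelG hk
  have hG : ∀ᵐ x, ‖kernelG k x‖ ≤ B x + C := ae_ne_zero.mono fun x hx =>
    norm_kernelG_le_of_majorant hk (B := fun x => B x + C) h hx
  have hTm : ∀ n : ℕ, AEStronglyMeasurable (kernelTrunc k n) volume := fun n =>
    (continuous_kernelTrunc hk n.cast_nonneg).aestronglyMeasurable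
  have hT : ∀ n : ℕ, ∀ᵐ x, ‖kernelTrunc k n x‖ ≤ B x + C := fun n =>
    ae_ne_zero.mono fun x hx => h n x n.cast_nonneg hx
  -- The same sequence of truncated pairings is evaluated in two ways: by dominated convergence of
  -- the kernels, and as a frequency integral over `[0, n]`.
  have h1 : Tendsto (fun n : ℕ => ∫ x, (∫ y, kernelTrunc k n (x - y) * g y) * testOp k ψ x) atTop
      (𝓝 (∫ x, (∫ y, kernelG k (x - y) * g y) * testOp k ψ x)) := by
    simp only [integral_conv_mul_test hB hGm hG hg, integral_conv_mul_test hB (hTm _) (hT _) hg]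
    refine tendsto_integral_of_dominated_convergence _
      (fun n => (integrable_conv_mul hB (hTm n) (hT n) hg (testOp k ψ)).aestronglyMeasurable)
      (integrable_majorant_conv hB C hg (testOp k ψ)) (fun n => ?_) ?_
    · filter_upwards [ae_prod_sub (hT n)] with p hp
      rw [norm_mul, norm_mul]
      gcongr
    · filter_upwards [ae_prod_sub ae_ne_zero] with p hp
      exact (((tendsto_kernelTrunc hk hp).comp tendsto_natCast_atTop_atTop).mul_const _).mul_const _
  have h2 : Tendsto (fun n : ℕ => ∫ x, (∫ y, kernelTrunc k n (x - y) * g y) * testOp k ψ x) atTop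
      (𝓝 (cauchyPlus g ψ)) := by
    simp only [fun n : ℕ => integral_kernelTrunc_conv_testOp hk hg (n.cast_nonneg (α := ℝ)) ψ]
    exact (intervalIntegral_tendsto_integral_Ioi 0 (integrable_fourierHat_mul hg ψ).integrableOn
      tendsto_natCast_atTop_atTop).const_mul _
  exact tendsto_nhds_unique h1 h2

/-! ### Integrating the equation in the half plane -/

/-- Path integral from `0` to `z`, first along the real line and then vertically. -/
noncomputable def cornerIntegral (f : ℂ → ℂ) (z : ℂ) : ℂ :=
  (∫ s in (0 : ℝ)..z.re, f s) + Complex.I * ∫ y in (0 : ℝ)..z.im, f (z.re + y * Complex.I)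

theorem continuous_vertical {f : ℂ → ℂ} (hf : ContinuousOn f {z : ℂ | 0 ≤ z.im}) (x : ℝ) {a b : ℝ}
    (ha : 0 ≤ a) (hb : 0 ≤ b) :
    IntervalIntegrable (fun y : ℝ => f (x + y * Complex.I)) volume a b := by
  refine ContinuousOn.intervalIntegrable (hf.comp (by fun_prop) fun y hy => ?_)
  simpa using (le_min ha hb).trans hy.1

theorem continuous_restrict_real {f : ℂ → ℂ} (hf : ContinuousOn f {z : ℂ | 0 ≤ z.im}) :
    Continuous fun x : ℝ => f x :=
  hf.comp_continuous Complex.continuous_ofReal (by simp)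

/-- Cauchy's theorem on the rectangle between the real line and height `Im z`. Its lower edge lies
on the boundary, where `f` is only continuous. -/
theorem cornerIntegral_sub {f : ℂ → ℂ} (hf : ContinuousOn f {z : ℂ | 0 ≤ z.im})
    (hd : DifferentiableOn ℂ f {z : ℂ | 0 < z.im}) {z w : ℂ} (hz : 0 < z.im) (hw : 0 < w.im) :
    cornerIntegral f w = cornerIntegral f z + Complex.wedgeIntegral z w f := by
  have hrect := Complex.integral_boundary_rect_eq_zero_of_continuousOn_of_differentiableOn f
    (z.re : ℂ) (⟨w.re, z.im⟩ : ℂ) (hf.mono fun v hv => ?_) (hd.mono fun v hv => ?_)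
  · simp only [Complex.ofReal_re, Complex.ofReal_im, Complex.ofReal_zero, zero_mul, add_zero,
      smul_eq_mul] at hrect
    have h1 := intervalIntegral.integral_add_adjacent_intervals
      ((continuous_restrict_real hf).intervalIntegrable 0 z.re)
      ((continuous_restrict_real hf).intervalIntegrable z.re w.re) (μ := volume)
    have h2 := intervalIntegral.integral_add_adjacent_intervals
      (continuous_vertical hf w.re le_rfl hz.le) (continuous_vertical hf w.re hz.le hw.le)
    simp only [cornerIntegral, Complex.wedgeIntegral, smul_eq_mul]
    rw [← h1, ← h2]
    linear_combination hrect
  · have := (Complex.mem_reProdIm.1 hv).2.1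
    simpa [hz.le] using this
  · have := (Complex.mem_reProdIm.1 hv).2.1
    simpa [hz.le] using this

theorem hasDerivAt_cornerIntegral {f : ℂ → ℂ} (hf : ContinuousOn f {z : ℂ | 0 ≤ z.im})
    (hd : DifferentiableOn ℂ f {z : ℂ | 0 < z.im}) {z : ℂ} (hz : 0 < z.im) :
    HasDerivAt (cornerIntegral f) (f z) z := by
  obtain ⟨r, hr, hball⟩ := Metric.isOpen_iff.1 isOpen_upperHalfPlane z hz
  have h := ((hd.mono hball).isConservativeOn.hasDerivAt_wedgeIntegral
    (hd.mono hball).continuousOn (Metric.mem_ball_self hr)).const_add (cornerIntegral f z)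
  refine h.congr_of_eventuallyEq ?_
  filter_upwards [isOpen_upperHalfPlane.mem_nhds hz] with w hw
  exact cornerIntegral_sub hf hd hz hw

theorem hasDerivAt_cornerIntegral_real {f : ℂ → ℂ} (hf : ContinuousOn f {z : ℂ | 0 ≤ z.im})
    (x : ℝ) : HasDerivAt (fun x : ℝ => cornerIntegral f x) (f x) x := by
  have hc := continuous_restrict_real hf
  have : (fun x : ℝ => cornerIntegral f x) = fun x : ℝ => ∫ s in (0 : ℝ)..x, f s := by
    funext x; simp [cornerIntegral]
  rw [this]
  exact intervalIntegral.integral_hasDerivAt_right (hc.intervalIntegrable _ _)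
    hc.stronglyMeasurable.stronglyMeasurableAtFilter hc.continuousAt

theorem cornerIntegral_vertical (f : ℂ → ℂ) (x y : ℝ) :
    cornerIntegral f (x + y * Complex.I) = cornerIntegral f x +
      Complex.I * ∫ t in (0 : ℝ)..y, f (x + t * Complex.I) := by
  simp [cornerIntegral]

/-- A bounded function solving `-i r' - l r = V`, `l > 0`, with `V` of class `UniformHardy`, is
itself the boundary value of a `UniformHardy` function. -/
theorem exists_uniformHardy_of_ode {l : ℝ} (hl : 0 < l) {V : ℂ → ℂ} (hV : UniformHardy V)
    {r : ℝ → ℂ} (hr : LocallyIntegrable r) {M : ℝ} (hM : ∀ᵐ x, ‖r x‖ ≤ M)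
    (h : ∀ ψ : 𝓢(ℝ, ℂ), ∫ x, r x * testOp l ψ x = ∫ x : ℝ, V x * ψ x) :
    ∃ G, UniformHardy G ∧ ∀ᵐ x : ℝ, r x = G x := by
  obtain ⟨A, hA0, hA⟩ := hV.exists_pos_bound
  -- Integrating factor: `R(z) = e^{ilz} ∫₀^z i e^{-ilζ} V(ζ) dζ` satisfies `R' = i l R + i V`, that
  -- is `-i R' - l R = V`. On the real line `r - R` is therefore a multiple of `e^{ilx}`.
  set f : ℂ → ℂ := fun z => Complex.I * (Complex.exp (-(Complex.I * l * z)) * V z) with hf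
  have hfc : ContinuousOn f {z : ℂ | 0 ≤ z.im} :=
    continuousOn_const.mul ((Continuous.continuousOn (by fun_prop)).mul
      hV.uniformContinuousOn.continuousOn)
  have hfd : DifferentiableOn ℂ f {z : ℂ | 0 < z.im} :=
    ((Differentiable.differentiableOn (by fun_prop)).mul hV.differentiableOn).const_mul _
  set P := cornerIntegral f with hP
  set R : ℂ → ℂ := fun z => Complex.exp (Complex.I * l * z) * P z with hR
  have hexp : ∀ z : ℂ, HasDerivAt (fun z : ℂ => Complex.exp (Complex.I * l * z))
      (Complex.exp (Complex.I * l * z) * (Complex.I * l)) z := fun z => by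
    simpa using ((hasDerivAt_id z).const_mul (Complex.I * (l : ℂ))).cexp
  have hEE : ∀ z : ℂ, Complex.exp (Complex.I * l * z) * Complex.exp (-(Complex.I * l * z)) = 1 :=
    fun z => by rw [← Complex.exp_add, add_neg_cancel, Complex.exp_zero]
  have hRd : ∀ z : ℂ, 0 < z.im →
      HasDerivAt R (Complex.I * l * R z + Complex.I * V z) z := fun z hz => by
    refine ((hexp z).mul (hasDerivAt_cornerIntegral hfc hfd hz)).congr_deriv ?_
    simp only [hR, hf]
    linear_combination (Complex.I * V z) * hEE z
  have hRr : ∀ x : ℝ, HasDerivAt (fun x : ℝ => R x) (Complex.I * l * R x + Complex.I * V x) x :=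
    fun x => by
    refine ((hexp x).comp_ofReal.mul (hasDerivAt_cornerIntegral_real hfc x)).congr_deriv ?_
    simp only [hR, hf]
    linear_combination (Complex.I * V x) * hEE x
  have hRc : Continuous fun x : ℝ => R x :=
    continuous_iff_continuousAt.2 fun x => (hRr x).continuousAt
  have hVc := hV.continuous_real
  obtain ⟨c, hc⟩ := exists_eq_const_mul_exp (k := l) (d := fun x => r x - R x)
    (hr.sub hRc.locallyIntegrable) (fun ψ hψs hψc => by
      have hψ' : Continuous (deriv ψ) := hψs.continuous_deriv (by norm_num)
      have hψd : ∀ x, HasDerivAt ψ (deriv ψ x) x := fun x =>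
        ((hψs.differentiable (by norm_num)) x).hasDerivAt
      have hop : ∀ x, testOp l (hψc.toSchwartzMap hψs) x = Complex.I * deriv ψ x - l * ψ x :=
        fun x => testOp_apply _ _ _
      have h1 := h (hψc.toSchwartzMap hψs)
      simp only [hop, HasCompactSupport.toSchwartzMap_toFun] at h1
      have hopc : HasCompactSupport fun x => Complex.I * deriv ψ x - l * ψ x :=
        (hψc.deriv.mul_left).sub hψc.mul_left
      have hopcont : Continuous fun x => Complex.I * deriv ψ x - l * ψ x :=
        (continuous_const.mul hψ').sub (continuous_const.mul hψs.continuous)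
      have hi1 : Integrable fun x => r x * (Complex.I * deriv ψ x - l * ψ x) := by
        simpa using hr.integrable_smul_right_of_hasCompactSupport hopcont hopc
      have hi2 : Integrable fun x : ℝ => R x * (Complex.I * deriv ψ x - l * ψ x) :=
        (hRc.mul hopcont).integrable_of_hasCompactSupport hopc.mul_left
      have hi3 : Integrable fun x : ℝ => V x * ψ x :=
        (hVc.mul hψs.continuous).integrable_of_hasCompactSupport hψc.mul_left
      have h0 := integral_eq_zero_of_hasDerivAt_of_integrable
        (f := fun x : ℝ => Complex.I * (R x * ψ x))
        (f' := fun x : ℝ => R x * (Complex.I * deriv ψ x - l * ψ x) - V x * ψ x)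
        (fun x => (((hRr x).mul (hψd x)).const_mul Complex.I).congr_deriv (by
          linear_combination (l * R x * ψ x + V x * ψ x) * Complex.I_mul_I)) (hi2.sub hi3)
        ((continuous_const.mul (hRc.mul hψs.continuous)).integrable_of_hasCompactSupport
          hψc.mul_left.mul_left)
      rw [integral_sub hi2 hi3] at h0
      simp only [sub_mul]
      rw [integral_sub hi1 hi2, h1]
      linear_combination -h0)
  have hexp1 : ∀ x : ℝ, ‖Complex.exp (Complex.I * (l : ℂ) * (x : ℂ))‖ = 1 := fun x => by
    rw [norm_exp_I_mul]; simp
  set K := M + ‖c‖ with hK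
  -- The bound on `r` passes to `R` only almost everywhere; the set where it holds is closed, so it
  -- holds everywhere.
  have hRK : ∀ x : ℝ, ‖R x‖ ≤ K := by
    have hcl : IsClosed {x : ℝ | ‖R x‖ ≤ K} := isClosed_le hRc.norm continuous_const
    have hae : {x : ℝ | ‖R x‖ ≤ K} =ᵐ[volume] Set.univ := by
      rw [eventuallyEq_univ]
      filter_upwards [hM, hc] with x hx hx'
      have : R x = r x - c * Complex.exp (Complex.I * (l : ℂ) * (x : ℂ)) := by rw [← hx']; ring
      change ‖R x‖ ≤ K
      rw [this]
      refine (norm_sub_le _ _).trans ?_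
      rw [norm_mul, hexp1, mul_one]
      exact add_le_add_left hx _
    have := (hcl.ae_eq_univ_iff_eq).1 hae
    exact Set.eq_univ_iff_forall.1 this
  have hPR : ∀ x : ℝ, ‖P x‖ = ‖R x‖ := fun x => by rw [hR, norm_mul, hexp1, one_mul]
  have hfb : ∀ x y : ℝ, 0 ≤ y → ‖f (x + y * Complex.I)‖ ≤ A * Real.exp (l * y) := fun x y hy => by
    rw [hf, norm_mul, norm_mul, Complex.norm_I, one_mul, Complex.norm_exp, mul_comm]
    have h1 := hA (x + y * Complex.I) (by simpa using hy)
    have h2 : (-(Complex.I * l * (x + y * Complex.I))).re = l * y := by simp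
    rw [h2]
    gcongr
  -- The vertical part of the path integral may grow like `e^{ly}`, which is compensated by
  -- `|e^{ilz}| = e^{-ly}` in the bound for `R` below.
  have hvert : ∀ x y : ℝ, 0 ≤ y → ‖Complex.I * ∫ t in (0 : ℝ)..y, f (x + t * Complex.I)‖ ≤
      A / l * (Real.exp (l * y) - 1) := fun x y hy => by
    rw [norm_mul, Complex.norm_I, one_mul]
    refine (intervalIntegral.norm_integral_le_of_norm_le hy
      (ae_of_all _ fun t ht => hfb x t ht.1.le)
      (Continuous.intervalIntegrable (by fun_prop) _ _)).trans_eq ?_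
    have hd : ∀ t ∈ Set.uIcc 0 y, HasDerivAt (fun t => A / l * Real.exp (l * t))
        (A * Real.exp (l * t)) t := fun t _ => by
      have := (((hasDerivAt_id t).const_mul l).exp).const_mul (A / l)
      refine this.congr_deriv ?_
      simp only [id]
      field_simp
    rw [intervalIntegral.integral_eq_sub_of_hasDerivAt hd
      (Continuous.intervalIntegrable (by fun_prop) _ _)]
    simp
    ring
  have hRb : ∀ z : ℂ, 0 < z.im → ‖R z‖ ≤ K + A / l := fun z hz => by
    have hz' : z = z.re + z.im * Complex.I := (Complex.re_add_im z).symm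
    have h1 : ‖P z‖ ≤ K + A / l * (Real.exp (l * z.im) - 1) := by
      rw [hz', hP, cornerIntegral_vertical]
      refine (norm_add_le _ _).trans (add_le_add ?_ ?_)
      · rw [← hP, hPR]; exact hRK _
      · simpa using hvert z.re z.im hz.le
    have h2 : ‖Complex.exp (Complex.I * l * z)‖ = Real.exp (-(l * z.im)) := by
      rw [Complex.norm_exp]; simp
    have hK0 : 0 ≤ K := (norm_nonneg _).trans (hRK 0)
    have hlz : 0 ≤ l * z.im := by positivity
    have hE : Real.exp (-(l * z.im)) * Real.exp (l * z.im) = 1 := by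
      rw [← Real.exp_add]; simp
    have hE1 : Real.exp (-(l * z.im)) ≤ 1 := Real.exp_le_one_iff.2 (by linarith)
    rw [hR, norm_mul, h2]
    calc _ ≤ Real.exp (-(l * z.im)) * (K + A / l * (Real.exp (l * z.im) - 1)) := by gcongr
      _ = Real.exp (-(l * z.im)) * K + A / l - A / l * Real.exp (-(l * z.im)) := by
        linear_combination (A / l) * hE
      _ ≤ 1 * K + A / l - 0 := by gcongr; positivity
      _ = _ := by ring
  have hRH : UniformHardy R := by
    refine uniformHardy_of_deriv_bound hRd hRb (D := l * (K + A / l) + A) (fun z hz => ?_)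
      fun z hz => ?_
    · refine (norm_add_le _ _).trans ?_
      simp only [norm_mul, Complex.norm_I, one_mul, Complex.norm_real, Real.norm_eq_abs,
        abs_of_pos hl]
      have := hRb z hz
      have := hA z hz.le
      gcongr
    · rcases eq_or_lt_of_le hz with h0 | h0
      · have hzx : z = (z.re : ℂ) := Complex.ext (by simp) (by simpa using h0.symm)
        rw [hzx]
        refine Tendsto.mul ?_ ?_
        · have : Continuous fun y : ℝ =>
              Complex.exp (Complex.I * l * ((z.re : ℂ) + (y : ℂ) * Complex.I)) := by fun_prop
          simpa using (this.tendsto 0).mono_left nhdsWithin_le_nhds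
        · simp only [hP, cornerIntegral_vertical]
          rw [tendsto_iff_norm_sub_tendsto_zero]
          simp only [add_sub_cancel_left]
          have hlim : Tendsto (fun y : ℝ => A / l * (Real.exp (l * y) - 1)) (𝓝[>] 0) (𝓝 0) := by
            have : Continuous fun y : ℝ => A / l * (Real.exp (l * y) - 1) := by fun_prop
            simpa using (this.tendsto 0).mono_left nhdsWithin_le_nhds
          refine squeeze_zero' (Eventually.of_forall fun _ => norm_nonneg _) ?_ hlim
          filter_upwards [self_mem_nhdsWithin] with y (hy : 0 < y) using hvert _ y hy.le
      · have h1 : Tendsto (fun y : ℝ => z + (y : ℂ) * Complex.I) (𝓝[>] 0) (𝓝 z) := by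
          have : Continuous fun y : ℝ => z + (y : ℂ) * Complex.I := by fun_prop
          simpa using (this.tendsto 0).mono_left nhdsWithin_le_nhds
        exact (hRd z h0).continuousAt.tendsto.comp h1
  refine ⟨_, hRH.add ((uniformHardy_exp hl.le).const_mul c), hc.mono fun x hx => ?_⟩
  rw [← hx]
  ring

/-! ### The boundary kernels -/

/-- Parseval's identity against a test function. -/
theorem integral_fourierHat_mul {g : ℝ → ℂ} (hg : Integrable g) (ψ : 𝓢(ℝ, ℂ)) :
    1 / (2 * (Real.pi : ℂ)) * ∫ ξ, fourierHat g ξ * fourierHat (fun x => ψ x) (-ξ) =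
      ∫ x, g x * ψ x := by
  have hpi : (0 : ℝ) < 2 * Real.pi := by positivity
  have h1 : ∫ ξ, fourierHat g ξ * fourierHat (fun x => ψ x) (-ξ) =
      (2 * (Real.pi : ℂ)) * ∫ η, FourierTransform.fourier g η *
        FourierTransform.fourierInv (fun x => ψ x) η := by
    have := Measure.integral_comp_div (fun η => FourierTransform.fourier g η *
        FourierTransform.fourierInv (fun x => ψ x) η) (2 * Real.pi)
    rw [abs_of_pos hpi] at this
    rw [← Complex.ofReal_ofNat, ← Complex.ofReal_mul, ← Complex.real_smul, ← this]
    congr 1 with ξ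
    rw [fourierHat_eq_fourier, fourierHat_eq_fourier, Real.fourierInv_eq_fourier_neg, neg_div]
  have h2 : ∫ η, FourierTransform.fourier g η * FourierTransform.fourierInv (fun x => ψ x) η =
      ∫ x, g x * ψ x := by
    -- The Fourier transform is moved from `g` onto the inverse transform of `ψ`, where it cancels.
    have := VectorFourier.integral_bilin_fourierIntegral_eq_flip (f := g)
      (g := fun x => (FourierTransform.fourierInv ψ : 𝓢(ℝ, ℂ)) x) (μ := volume) (ν := volume)
      (ContinuousLinearMap.mul ℂ ℂ) (L := innerₗ ℝ) Real.continuous_fourierChar continuous_inner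
      hg (SchwartzMap.integrable _)
    have hinv : ∀ x, FourierTransform.fourier
        (fun x => (FourierTransform.fourierInv ψ : 𝓢(ℝ, ℂ)) x) x = ψ x := fun x => by
      have h := FourierTransform.fourier_fourierInv_eq (E := 𝓢(ℝ, ℂ)) (F := 𝓢(ℝ, ℂ)) ψ
      exact congrArg (fun φ : 𝓢(ℝ, ℂ) => φ x) h
    simp only [flip_innerₗ] at this
    refine Eq.trans ?_ (this.trans ?_)
    · congr 1 with η
      simp only [ContinuousLinearMap.mul_apply']
      rw [SchwartzMap.fourierInv_coe]
      rfl
    · congr 1 with x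
      simp only [ContinuousLinearMap.mul_apply']
      exact congrArg _ (hinv x)
  have : (Real.pi : ℂ) ≠ 0 := by exact_mod_cast Real.pi_ne_zero
  rw [h1, h2]
  field_simp

/-- The singular part of `kernelGBdry l Side.above`. -/
noncomputable def stepKernel (l : ℝ) : ℝ → ℂ :=
  (Set.Ioi (0 : ℝ)).indicator fun t : ℝ => Complex.I * Complex.exp (Complex.I * (l : ℂ) * (t : ℂ))

theorem norm_stepKernel_le (l t : ℝ) : ‖stepKernel l t‖ ≤ 1 := by
  refine (norm_indicator_le_norm_self _ _).trans ?_
  rw [norm_mul, norm_exp_I_mul]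
  simp

theorem aestronglyMeasurable_stepKernel (l : ℝ) : AEStronglyMeasurable (stepKernel l) volume :=
  (Continuous.aestronglyMeasurable (by fun_prop)).indicator measurableSet_Ioi

theorem ae_norm_stepKernel_le (l : ℝ) : ∀ᵐ x, ‖stepKernel l x‖ ≤ (0 : ℝ) + 1 :=
  ae_of_all _ fun x => by simpa using norm_stepKernel_le l x

/-- On `(y, ∞)` the integrand is the derivative of `-e^{il(x-y)} ψ(x)`, so only the endpoint `y`
contributes: `stepKernel l` is a fundamental solution of `-i ∂ - l`. -/
theorem integral_stepKernel_testOp (l : ℝ) (ψ : 𝓢(ℝ, ℂ)) (y : ℝ) :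
    ∫ x, stepKernel l (x - y) * testOp l ψ x = ψ y := by
  set e : ℝ → ℂ := fun x => Complex.exp (Complex.I * (l : ℂ) * ((x - y : ℝ) : ℂ)) with he
  have he1 : ∀ x, ‖e x‖ = 1 := fun x => by rw [he, norm_exp_I_mul]; simp
  have hed : ∀ x, HasDerivAt e (e x * (Complex.I * l)) x := fun x =>
    (hasDerivAt_exp_I_mul l (x - y)).comp_sub_const x y
  have hind : ∀ x, stepKernel l (x - y) * testOp l ψ x =
      (Set.Ioi y).indicator (fun x => Complex.I * e x * testOp l ψ x) x := fun x => by
    by_cases hx : y < x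
    · rw [Set.indicator_of_mem (by exact hx), stepKernel,
        Set.indicator_of_mem (by simpa using hx)]
    · rw [Set.indicator_of_notMem (by exact hx), stepKernel,
        Set.indicator_of_notMem (by simpa using hx), zero_mul]
  simp only [hind]
  rw [integral_indicator measurableSet_Ioi]
  have hint : Integrable fun x => Complex.I * e x * testOp l ψ x :=
    (testOp l ψ).integrable.bdd_mul (c := 1) (Continuous.aestronglyMeasurable (by fun_prop))
      (ae_of_all _ fun x => by rw [norm_mul, he1]; simp)
  have hlim : Tendsto (fun x => -(e x * ψ x)) atTop (𝓝 0) := by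
    rw [tendsto_zero_iff_norm_tendsto_zero]
    simp only [norm_neg, norm_mul, he1, one_mul]
    exact (tendsto_zero_iff_norm_tendsto_zero.1 ψ.tendsto_cocompact).mono_left atTop_le_cocompact
  rw [integral_Ioi_of_hasDerivAt_of_tendsto' (f := fun x => -(e x * ψ x)) (fun x _ => ?_)
    hint.integrableOn hlim]
  · simp [he]
  · refine ((hed x).mul ψ.differentiableAt.hasDerivAt).neg.congr_deriv ?_
    rw [testOp_apply]
    linear_combination (-(e x * deriv (fun t => ψ t) x)) * Complex.I_mul_I

/-- For `g ∈ L¹`, the convolution with `stepKernel l` solves `-i f' - l f = g`. -/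
theorem integral_stepKernel_conv_testOp (l : ℝ) {g : ℝ → ℂ} (hg : Integrable g) (ψ : 𝓢(ℝ, ℂ)) :
    ∫ x, (∫ y, stepKernel l (x - y) * g y) * testOp l ψ x = ∫ x, g x * ψ x := by
  have hK := aestronglyMeasurable_stepKernel l
  have hb := ae_norm_stepKernel_le l
  have h0 : Integrable fun _ : ℝ => (0 : ℝ) := integrable_zero _ _ _
  rw [integral_conv_mul_test h0 hK hb hg,
    integral_prod_symm _ (integrable_conv_mul h0 hK hb hg (testOp l ψ))]
  congr 1 with y
  rw [← integral_stepKernel_testOp l ψ y, ← integral_const_mul]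
  congr 1 with x
  ring

theorem neg_notMem_nonnegRay {l : ℝ} (hl : 0 < l) : (-(l : ℂ)) ∉ nonnegRay := by
  rintro ⟨t, ht, h⟩
  have : t = -l := Complex.ofReal_injective (by simpa using h)
  have h0 : (0 : ℝ) ≤ t := ht
  linarith

/-- The substitution `ξ ↦ -ξ` turns the negative-frequency kernel at `l` into the kernel at `-l`,
which is off the ray, so the earlier estimates apply to it. -/
theorem kernelGTilde_eq {l : ℝ} (hl : 0 < l) {x : ℝ} (hx : x ≠ 0) :
    kernelGTilde l x = -kernelG (-(l : ℂ)) (-x) := by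
  have hpi : (2 * (Real.pi : ℂ)) ≠ 0 := by
    have : (Real.pi : ℂ) ≠ 0 := by exact_mod_cast Real.pi_ne_zero
    simp [this]
  have h := tendsto_kernelTrunc (neg_notMem_nonnegRay hl) (neg_ne_zero.2 hx)
  have h2 := (h.const_mul (2 * (Real.pi : ℂ))).neg
  have heq : (fun R : ℝ => ∫ ξ in (-R)..(0 : ℝ),
      Complex.exp (Complex.I * (x : ℂ) * (ξ : ℂ)) / ((ξ : ℂ) - (l : ℂ))) =
      fun R : ℝ => -(2 * (Real.pi : ℂ) * kernelTrunc (-(l : ℂ)) R (-x)) := by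
    funext R
    have hneg := intervalIntegral.integral_comp_neg (a := 0) (b := R) fun ξ : ℝ =>
      Complex.exp (Complex.I * (x : ℂ) * (ξ : ℂ)) / ((ξ : ℂ) - (l : ℂ))
    rw [neg_zero] at hneg
    rw [← hneg, kernelTrunc, ← mul_assoc, mul_one_div_cancel hpi, one_mul,
      ← intervalIntegral.integral_neg]
    congr 1 with ξ
    push_cast
    rw [← div_neg]
    congr 1
    · congr 1; ring
    · ring
  rw [kernelGTilde, heq, h2.limUnder_eq]
  field_simp

theorem kernelGBdry_above {l : ℝ} (hl : 0 < l) {x : ℝ} (hx : x ≠ 0) :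
    kernelGBdry l Side.above x = stepKernel l x + kernelG (-(l : ℂ)) (-x) := by
  simp only [kernelGBdry, stepKernel, kernelGTilde_eq hl hx, sub_neg_eq_add]

/-- Away from `0` exactly one of the two indicators is active, so the kernels differ by the full
exponential `i e^{ilx}`. This reduces the lower sign to the upper one. -/
theorem kernelGBdry_below {l : ℝ} {x : ℝ} (hx : x ≠ 0) :
    kernelGBdry l Side.below x = kernelGBdry l Side.above x -
      Complex.I * Complex.exp (Complex.I * (l : ℂ) * (x : ℂ)) := by
  simp only [kernelGBdry]
  rcases lt_or_gt_of_ne hx with h | h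
  · rw [Set.indicator_of_mem (by exact h), Set.indicator_of_notMem (by simpa using h.le)]
    ring
  · rw [Set.indicator_of_notMem (by simpa using h.le), Set.indicator_of_mem (by exact h)]
    ring

theorem ae_sub_ne_zero (x : ℝ) : ∀ᵐ y : ℝ, x - y ≠ 0 := by
  have : ∀ᵐ y : ℝ, y ≠ x := by simp [ae_iff]
  exact this.mono fun y hy => sub_ne_zero.2 hy.symm

theorem memLp_comp_neg {f : ℝ → ℂ} {p : ℝ≥0∞} (hf : MemLp f p) : MemLp (fun y => f (-y)) p :=
  hf.comp_measurePreserving (Measure.measurePreserving_neg volume)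

theorem integrable_stepKernel_conv (l : ℝ) {g : ℝ → ℂ} (hg : Integrable g) (x : ℝ) :
    Integrable fun y => stepKernel l (x - y) * g y :=
  hg.bdd_mul (c := 1) ((aestronglyMeasurable_stepKernel l).comp_quasiMeasurePreserving
    (Measure.measurePreserving_sub_left volume x).quasiMeasurePreserving)
    (ae_of_all _ fun _ => norm_stepKernel_le l _)

theorem integral_kernelG_reflect (k : ℂ) (g : ℝ → ℂ) (x : ℝ) :
    ∫ y, kernelG k (-x - y) * g (-y) = ∫ y, kernelG k (-(x - y)) * g y := by
  rw [← integral_neg_eq_self]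
  congr 1 with y
  congr 2
  · ring
  · ring

theorem integrable_kernelG_reflect {k : ℂ} (hk : k ∉ nonnegRay) {g : ℝ → ℂ} {q : ℝ} (hq : 1 < q)
    (hgq : MemLp g (ENNReal.ofReal q)) (x : ℝ) :
    Integrable fun y => kernelG k (-(x - y)) * g y := by
  have hpq := (Real.HolderConjugate.conjExponent hq).symm
  have := (integrable_conv_of_holder hpq (memLp_kernelG hk hpq.lt) (memLp_comp_neg hgq) (-x)).comp_neg
  refine this.congr (ae_of_all _ fun y => ?_)
  simp only [neg_neg]
  congr 2
  ring

theorem kernelGBdry_above_conv {l : ℝ} (hl : 0 < l) {g : ℝ → ℂ} (hg : Integrable g) {q : ℝ}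
    (hq : 1 < q) (hgq : MemLp g (ENNReal.ofReal q)) (x : ℝ) :
    ∫ y, kernelGBdry l Side.above (x - y) * g y =
      (∫ y, stepKernel l (x - y) * g y) + ∫ y, kernelG (-(l : ℂ)) (-x - y) * g (-y) := by
  rw [integral_kernelG_reflect, ← integral_add (integrable_stepKernel_conv l hg x)
    (integrable_kernelG_reflect (neg_notMem_nonnegRay hl) hq hgq x)]
  refine integral_congr_ae ?_
  filter_upwards [ae_sub_ne_zero x] with y hy
  rw [kernelGBdry_above hl hy]
  ring

theorem kernelGBdry_below_conv {l : ℝ} (hl : 0 < l) {g : ℝ → ℂ} (hg : Integrable g) {q : ℝ}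
    (hq : 1 < q) (hgq : MemLp g (ENNReal.ofReal q)) (x : ℝ) :
    ∫ y, kernelGBdry l Side.below (x - y) * g y =
      (∫ y, kernelGBdry l Side.above (x - y) * g y) -
        Complex.I * fourierHat g l * Complex.exp (Complex.I * (l : ℂ) * (x : ℂ)) := by
  have hint : Integrable fun y => kernelGBdry l Side.above (x - y) * g y := by
    refine ((integrable_stepKernel_conv l hg x).add
      (integrable_kernelG_reflect (neg_notMem_nonnegRay hl) hq hgq x)).congr ?_
    filter_upwards [ae_sub_ne_zero x] with y hy
    rw [kernelGBdry_above hl hy, Pi.add_apply]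
    ring
  have h2 : Complex.I * fourierHat g l * Complex.exp (Complex.I * (l : ℂ) * (x : ℂ)) =
      ∫ y : ℝ, Complex.I * Complex.exp (Complex.I * (l : ℂ) * (x : ℂ)) *
        (Complex.exp (-(Complex.I * (l : ℂ) * (y : ℂ))) * g y) := by
    rw [integral_const_mul, fourierHat]; ring
  rw [h2, ← integral_sub hint ((integrable_exp_neg_mul hg l).const_mul _)]
  refine integral_congr_ae ?_
  filter_upwards [ae_sub_ne_zero x] with y hy
  have : Complex.exp (Complex.I * (l : ℂ) * ((x - y : ℝ) : ℂ)) =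
      Complex.exp (Complex.I * (l : ℂ) * (x : ℂ)) *
        Complex.exp (-(Complex.I * (l : ℂ) * (y : ℂ))) := by
    rw [← Complex.exp_add]; congr 1; push_cast; ring
  rw [kernelGBdry_below hy, this]
  ring

/-- The reflection of a test function. -/
noncomputable def reflect (ψ : 𝓢(ℝ, ℂ)) : 𝓢(ℝ, ℂ) :=
  SchwartzMap.compCLMOfContinuousLinearEquiv ℂ (ContinuousLinearEquiv.neg ℝ) ψ

theorem reflect_apply (ψ : 𝓢(ℝ, ℂ)) (x : ℝ) : reflect ψ x = ψ (-x) := rfl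

theorem testOp_neg (l : ℝ) (ψ : 𝓢(ℝ, ℂ)) (x : ℝ) :
    testOp l ψ (-x) = -testOp (-(l : ℂ)) (reflect ψ) x := by
  have : deriv (fun t => reflect ψ t) x = -deriv (fun t => ψ t) (-x) := by
    have h : (fun t => reflect ψ t) = fun t => (fun s => ψ s) (-t) := rfl
    rw [h, deriv_comp_neg]
  rw [testOp_apply, testOp_apply, this, reflect_apply]
  ring

theorem fourierHat_comp_neg (f : ℝ → ℂ) (ξ : ℝ) :
    fourierHat (fun x => f (-x)) ξ = fourierHat f (-ξ) := by
  rw [fourierHat, fourierHat, ← integral_neg_eq_self]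
  congr 1 with x
  simp

/-- For `g ∈ L¹ ∩ L^q`, `G_{l + 0i} * g` is bounded and solves `-i f' - l f = C₊ g`. -/
theorem kernelGBdry_above_spec {l : ℝ} (hl : 0 < l) {g : ℝ → ℂ} (hg : Integrable g) {q : ℝ}
    (hq : 1 < q) (hgq : MemLp g (ENNReal.ofReal q)) :
    AEStronglyMeasurable (fun x => ∫ y, kernelGBdry l Side.above (x - y) * g y) volume ∧
    (∃ M : ℝ, ∀ x, ‖∫ y, kernelGBdry l Side.above (x - y) * g y‖ ≤ M) ∧
    ∀ ψ : 𝓢(ℝ, ℂ), ∫ x, (∫ y, kernelGBdry l Side.above (x - y) * g y) * testOp l ψ x =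
      cauchyPlus g ψ := by
  have hk := neg_notMem_nonnegRay hl
  have hgn : Integrable fun y => g (-y) := hg.comp_neg
  -- The regular part of the convolution is `W (-x)`, with `W` obtained off the ray from the
  -- reflected `g`.
  obtain ⟨W, hW, hWeq⟩ := exists_uniformHardy_kernelG_conv hk hgn hq (memLp_comp_neg hgq)
  obtain ⟨A, hA0, hA⟩ := hW.exists_pos_bound
  have hWc := hW.continuous_real
  have heq : ∀ x, ∫ y, kernelGBdry l Side.above (x - y) * g y =
      (∫ y, stepKernel l (x - y) * g y) + W ((-x : ℝ) : ℂ) := fun x => by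
    rw [kernelGBdry_above_conv hl hg hq hgq, hWeq]
  have hWn : Continuous fun x : ℝ => W ((-x : ℝ) : ℂ) := hWc.comp continuous_neg
  simp only [heq]
  refine ⟨(aestronglyMeasurable_conv (aestronglyMeasurable_stepKernel l)
    hg.aestronglyMeasurable).add hWn.aestronglyMeasurable, ⟨(∫ y, ‖g y‖) + A, fun x => ?_⟩,
    fun ψ => ?_⟩
  · refine (norm_add_le _ _).trans (add_le_add ?_ (hA _ (by simp)))
    refine norm_integral_le_of_norm_le hg.norm (ae_of_all _ fun y => ?_)
    rw [norm_mul]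
    exact mul_le_of_le_one_left (norm_nonneg _) (norm_stepKernel_le l _)
  · have hi1 : Integrable fun x => (∫ y, stepKernel l (x - y) * g y) * testOp l ψ x :=
      integrable_conv_mul_test (integrable_zero _ _ _) (aestronglyMeasurable_stepKernel l)
        (ae_norm_stepKernel_le l) hg _
    have hi2 : Integrable fun x : ℝ => W ((-x : ℝ) : ℂ) * testOp l ψ x :=
      (testOp l ψ).integrable.bdd_mul (c := A) hWn.aestronglyMeasurable
        (ae_of_all _ fun x => hA _ (by simp))
    -- The step kernel produces all of `g`; the reflected part subtracts its negative frequencies,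
    -- which leaves `C₊ g` by Parseval.
    have h3 : ∫ x : ℝ, W ((-x : ℝ) : ℂ) * testOp l ψ x =
        -cauchyPlus (fun y => g (-y)) (reflect ψ) := by
      rw [← integral_kernelG_conv_testOp hk hgn, ← integral_neg_eq_self, ← integral_neg]
      congr 1 with x
      rw [testOp_neg, hWeq, neg_neg]
      ring
    have h4 : cauchyPlus (fun y => g (-y)) (reflect ψ) = 1 / (2 * (Real.pi : ℂ)) *
        ∫ ξ in Set.Iic (0 : ℝ), fourierHat g ξ * fourierHat (fun x => ψ x) (-ξ) := by
      rw [cauchyPlus, ← neg_zero, ← integral_comp_neg_Ioi, neg_zero]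
      congr 2 with ξ
      have : (fun x => reflect ψ x) = fun x => (fun s => ψ s) (-x) := rfl
      rw [this, fourierHat_comp_neg, fourierHat_comp_neg]
    have h5 := intervalIntegral.integral_Iic_add_Ioi (b := (0 : ℝ))
      (integrable_fourierHat_mul hg ψ).integrableOn (integrable_fourierHat_mul hg ψ).integrableOn
    simp only [add_mul]
    rw [integral_add hi1 hi2, integral_stepKernel_conv_testOp l hg, h3, h4,
      ← integral_fourierHat_mul hg ψ, ← h5, cauchyPlus]
    ring

theorem locallyIntegrable_of_bound {f : ℝ → ℂ} (hf : AEStronglyMeasurable f volume) {M : ℝ}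
    (hM : ∀ᵐ x, ‖f x‖ ≤ M) : LocallyIntegrable f :=
  (memLp_top_of_bound hf M hM).locallyIntegrable le_top

/-- Convolution with `G_{l ± 0i}` maps `L¹ ∩ L^q`, `1 < q < ∞`, into the boundary values of
`UniformHardy` functions. -/
theorem exists_uniformHardy_kernelGBdry_conv {l : ℝ} (hl : 0 < l) {g : ℝ → ℂ} (hg : Integrable g)
    {q : ℝ} (hq : 1 < q) (hgq : MemLp g (ENNReal.ofReal q)) (σ : Side) :
    ∃ G, UniformHardy G ∧ ∀ᵐ x : ℝ, ∫ y, kernelGBdry l σ (x - y) * g y = G x := by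
  have hk := neg_notMem_nonnegRay hl
  obtain ⟨hm, ⟨M, hM⟩, hsol⟩ := kernelGBdry_above_spec hl hg hq hgq
  -- `V = G_{-l} * g` has the same right-hand side `C₊ g` with `-l` in place of `l`. In `f - V` the
  -- projection cancels and the source `2 l V`, already of class `UniformHardy`, remains.
  obtain ⟨V, hV, hVeq⟩ := exists_uniformHardy_kernelG_conv hk hg hq hgq
  obtain ⟨A, hA0, hA⟩ := hV.exists_pos_bound
  have hVc := hV.continuous_real
  set f : ℝ → ℂ := fun x => ∫ y, kernelGBdry l Side.above (x - y) * g y with hf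
  have hrb : ∀ x : ℝ, ‖f x - V x‖ ≤ M + A := fun x =>
    (norm_sub_le _ _).trans (add_le_add (hM x) (hA _ (by simp)))
  obtain ⟨G, hG, hGeq⟩ := exists_uniformHardy_of_ode hl (hV.const_mul (2 * l))
    (r := fun x => f x - V x)
    (locallyIntegrable_of_bound (hm.sub hVc.aestronglyMeasurable) (ae_of_all _ hrb))
    (ae_of_all _ hrb) (fun ψ => by
      have hVψ : ∀ φ : 𝓢(ℝ, ℂ), Integrable fun x : ℝ => V x * φ x := fun φ =>
        φ.integrable.bdd_mul (c := A) hVc.aestronglyMeasurable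
          (ae_of_all _ fun x => hA _ (by simp))
      have hfψ : Integrable fun x : ℝ => f x * testOp l ψ x :=
        (testOp l ψ).integrable.bdd_mul (c := M) hm (ae_of_all _ hM)
      have h1 := integral_kernelG_conv_testOp hk hg ψ
      simp only [hVeq] at h1
      have h2 : ∀ x : ℝ, V x * testOp l ψ x = V x * testOp (-(l : ℂ)) ψ x - 2 * l * V x * ψ x :=
        fun x => by rw [testOp_apply, testOp_apply]; ring
      have h3 : Integrable fun x : ℝ => 2 * l * V x * ψ x := by
        simpa only [mul_assoc] using (hVψ ψ).const_mul (2 * (l : ℂ))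
      have h4 : ∫ x : ℝ, V x * testOp l ψ x = cauchyPlus g ψ - ∫ x : ℝ, 2 * l * V x * ψ x := by
        simp only [h2]
        rw [integral_sub (hVψ _) h3, h1]
      simp only [sub_mul]
      rw [integral_sub hfψ (hVψ _), hsol ψ, h4]
      ring)
  have hGV := hG.add hV
  cases σ with
  | above => exact ⟨_, hGV, hGeq.mono fun x hx => by rw [← hx]; simp [hf]⟩
  | below =>
    refine ⟨_, hGV.sub ((uniformHardy_exp hl.le).const_mul (Complex.I * fourierHat g l)),
      hGeq.mono fun x hx => ?_⟩
    rw [kernelGBdry_below_conv hl hg hq hgq, ← hx]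
    simp [hf]

/-! ### Comparing solutions with convolutions -/

/-- Uniqueness for the inhomogeneous equation, up to a multiple of `e^{ikx}`. -/
theorem SolvesLax.exists_eq_const_mul_exp {u : ℝ → ℝ} {m h f : ℝ → ℂ} {k a : ℂ} {ω : ℝ}
    (hL : SolvesLax u m h) (hm : LocallyIntegrable m) (hf : LocallyIntegrable f)
    (hsol : ∀ ψ : 𝓢(ℝ, ℂ), ∫ x, f x * testOp k ψ x = cauchyPlus (fun x => (u x : ℂ) * m x) ψ)
    (hh : ∀ x : ℝ, h x =
      k * m x - (k - ω) * (a * Complex.exp (Complex.I * (ω : ℂ) * (x : ℂ)))) :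
    ∃ c : ℂ, ∀ᵐ x : ℝ, m x - a * Complex.exp (Complex.I * (ω : ℂ) * (x : ℂ)) - f x =
      c * Complex.exp (Complex.I * k * (x : ℂ)) := by
  -- The form of `hh` covers all cases at once: `a = 0` is the eigenvalue equation, `a = 1`, `ω = 0`
  -- the right-hand side `k (m - 1)`, and `a = 1`, `ω = k` the equation for `m_e`. It says that `m -
  -- a e^{iωx}` solves the equation with source `C₊ (u m)`.
  have hexpc : Continuous fun x : ℝ => a * Complex.exp (Complex.I * (ω : ℂ) * (x : ℂ)) := by
    fun_prop
  refine BenjaminOno.exists_eq_const_mul_exp ((hm.sub hexpc.locallyIntegrable).sub hf)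
    fun φ hφs hφc => ?_
  set ψ : 𝓢(ℝ, ℂ) := hφc.toSchwartzMap hφs with hψ
  have hψφ : ∀ x, ψ x = φ x := fun x => rfl
  have hop : ∀ x, Complex.I * deriv φ x - k * φ x = testOp k ψ x := fun x =>
    (testOp_apply k ψ x).symm
  have hφ' : Continuous (deriv φ) := hφs.continuous_deriv (by norm_num)
  have hopcont : Continuous fun x => testOp k ψ x := (testOp k ψ).continuous
  have hopc : HasCompactSupport fun x => testOp k ψ x := by
    simp only [← hop]
    exact (hφc.deriv.mul_left).sub hφc.mul_left
  have hint : ∀ d w : ℝ → ℂ, LocallyIntegrable d → Continuous w → HasCompactSupport w →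
      Integrable fun x => d x * w x := fun d w hd hw hwc => by
    simpa using hd.integrable_smul_right_of_hasCompactSupport hw hwc
  simp only [hop, sub_mul (_ - _), sub_mul (m _)]
  have hi1 := hint m _ hm hopcont hopc
  have hi2 := hint _ _ hexpc.locallyIntegrable hopcont hopc
  have hi3 := hint f _ hf hopcont hopc
  have hi12 : Integrable fun x : ℝ => m x * testOp k ψ x -
      a * Complex.exp (Complex.I * (ω : ℂ) * (x : ℂ)) * testOp k ψ x := hi1.sub hi2
  rw [integral_sub hi12 hi3, integral_sub hi1 hi2, hsol]
  have hmφ := hint m φ hm hφs.continuous hφc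
  have hmφ' := hint m _ hm hφ' hφc.deriv
  have heφ : Integrable fun x : ℝ => Complex.exp (Complex.I * (ω : ℂ) * (x : ℂ)) * ψ x :=
    integrable_exp_mul_schwartz ψ ω
  have h1 : ∫ x, m x * testOp k ψ x = Complex.I * (∫ x, m x * deriv φ x) - k * ∫ x, m x * φ x := by
    rw [← integral_const_mul, ← integral_const_mul,
      ← integral_sub (hmφ'.const_mul _) (hmφ.const_mul _)]
    congr 1 with x
    rw [← hop]
    ring
  have h2 : ∫ x, h x * ψ x = k * (∫ x, m x * φ x) - (k - ω) * a *
      ∫ x : ℝ, Complex.exp (Complex.I * (ω : ℂ) * (x : ℂ)) * ψ x := by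
    rw [← integral_const_mul, ← integral_const_mul,
      ← integral_sub (hmφ.const_mul _) (heφ.const_mul _)]
    congr 1 with x
    rw [hh, hψφ]
    ring
  have h3 : ∫ x : ℝ, a * Complex.exp (Complex.I * (ω : ℂ) * (x : ℂ)) * testOp k ψ x =
      (ω - k) * a * ∫ x : ℝ, Complex.exp (Complex.I * (ω : ℂ) * (x : ℂ)) * ψ x := by
    simp only [mul_assoc a]
    rw [integral_const_mul, integral_exp_mul_testOp, fourierHat_neg_eq]
    ring
  have h4 := hL ψ
  rw [laxL, h2] at h4
  have h5 : ∫ x, m x * deriv (fun t => ψ t) x = ∫ x, m x * deriv φ x := rfl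
  rw [h5] at h4
  rw [h1, h3]
  linear_combination h4

/-- Young's inequality for `L¹ * L^Q`, qualitatively. -/
theorem memLp_conv {K g : ℝ → ℂ} {Q : ℝ} (hQ : 1 < Q) (hK : MemLp K (ENNReal.ofReal Q))
    (hg : Integrable g) : MemLp (fun x => ∫ y, K (x - y) * g y) (ENNReal.ofReal Q) := by
  have hQ0 : 0 < Q := by linarith
  have hpq := Real.HolderConjugate.conjExponent hQ
  set Q' := Q.conjExponent
  refine ⟨aestronglyMeasurable_conv hK.1 hg.1, ?_⟩
  have hQne : ENNReal.ofReal Q ≠ 0 := by simpa using hQ0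
  rw [eLpNorm_lt_top_iff_lintegral_rpow_enorm_lt_top hQne ENNReal.ofReal_ne_top,
    ENNReal.toReal_ofReal hQ0.le]
  set A : ℝ≥0∞ := ∫⁻ y, ‖g y‖ₑ with hA
  have hAfin : A < ∞ := hg.2
  have hKm : AEMeasurable (fun x => ‖K x‖ₑ) volume := hK.1.enorm
  have hgm : AEMeasurable (fun x => ‖g x‖ₑ) volume := hg.1.enorm
  have hKx : ∀ x, AEMeasurable (fun y => ‖K (x - y)‖ₑ) volume := fun x =>
    (hK.1.comp_quasiMeasurePreserving
      (Measure.measurePreserving_sub_left volume x).quasiMeasurePreserving).enorm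
  -- Hölder after splitting `|g| = |g|^{1/Q} |g|^{1/Q'}`; integrating in `x` and using Tonelli then
  -- gives Young's inequality.
  have hpt : ∀ x, ‖∫ y, K (x - y) * g y‖ₑ ^ Q ≤
      (∫⁻ y, ‖K (x - y)‖ₑ ^ Q * ‖g y‖ₑ) * A ^ (Q / Q') := fun x => by
    have h1 : ‖∫ y, K (x - y) * g y‖ₑ ≤
        (∫⁻ y, ‖K (x - y)‖ₑ ^ Q * ‖g y‖ₑ) ^ (1 / Q) * A ^ (1 / Q') := by
      refine (enorm_integral_le_lintegral_enorm _).trans ?_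
      have h2 := ENNReal.lintegral_mul_le_Lp_mul_Lq volume hpq
        (f := fun y => ‖K (x - y)‖ₑ * ‖g y‖ₑ ^ (1 / Q)) (g := fun y => ‖g y‖ₑ ^ (1 / Q'))
        ((hKx x).mul (hgm.pow_const _)) (hgm.pow_const _)
      refine (lintegral_mono_ae (ae_of_all _ fun y => ?_)).trans (h2.trans_eq ?_)
      · rw [enorm_mul, Pi.mul_apply, mul_assoc, ← ENNReal.rpow_add_of_nonneg _ _
          (one_div_nonneg.2 hpq.nonneg) (one_div_nonneg.2 hpq.symm.nonneg), one_div, one_div,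
          hpq.inv_add_inv_eq_one, ENNReal.rpow_one]
      · congr 2
        · refine lintegral_congr fun y => ?_
          rw [ENNReal.mul_rpow_of_nonneg _ _ hQ0.le, ← ENNReal.rpow_mul,
            one_div_mul_cancel hQ0.ne', ENNReal.rpow_one]
        · refine lintegral_congr fun y => ?_
          rw [← ENNReal.rpow_mul, one_div_mul_cancel hpq.symm.ne_zero, ENNReal.rpow_one]
    refine (ENNReal.rpow_le_rpow h1 hQ0.le).trans_eq ?_
    rw [ENNReal.mul_rpow_of_nonneg _ _ hQ0.le, ← ENNReal.rpow_mul, ← ENNReal.rpow_mul,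
      one_div_mul_cancel hQ0.ne', ENNReal.rpow_one]
    congr 2
    ring
  refine (lintegral_mono hpt).trans_lt ?_
  rw [lintegral_mul_const' _ _ (ENNReal.rpow_ne_top_of_nonneg
    (div_nonneg hQ0.le hpq.symm.nonneg) hAfin.ne)]
  refine ENNReal.mul_lt_top ?_ (ENNReal.rpow_lt_top_of_nonneg
    (div_nonneg hQ0.le hpq.symm.nonneg) hAfin.ne)
  have hm2 : AEMeasurable (Function.uncurry fun x y : ℝ => ‖K (x - y)‖ₑ ^ Q * ‖g y‖ₑ)
      (volume.prod volume) :=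
    ((hKm.comp_quasiMeasurePreserving
      (quasiMeasurePreserving_sub_of_right_invariant volume volume)).pow_const Q).mul
      (hgm.comp_quasiMeasurePreserving Measure.quasiMeasurePreserving_snd)
  rw [lintegral_lintegral_swap hm2]
  have hin : ∀ y, ∫⁻ x, ‖K (x - y)‖ₑ ^ Q * ‖g y‖ₑ = (∫⁻ x, ‖K x‖ₑ ^ Q) * ‖g y‖ₑ := fun y => by
    rw [lintegral_mul_const' _ _ enorm_ne_top,
      lintegral_sub_right_eq_self (fun x => ‖K x‖ₑ ^ Q) y]
  simp only [hin]
  have hKfin : ∫⁻ x, ‖K x‖ₑ ^ Q < ∞ := by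
    have := lintegral_rpow_enorm_lt_top_of_eLpNorm_lt_top hQne ENNReal.ofReal_ne_top hK.2
    rwa [ENNReal.toReal_ofReal hQ0.le] at this
  rw [lintegral_const_mul' _ _ hKfin.ne]
  exact ENNReal.mul_lt_top hKfin hAfin

/-- A multiple of `e^{ikx}` which is the sum of an `L²` function and of a function vanishing at
infinity is zero. -/
theorem const_eq_zero_of_memLp {k c : ℂ} {e f : ℝ → ℂ} (hf : MemLp f 2)
    (he : Tendsto e (cocompact ℝ ⊓ ae volume) (𝓝 0))
    (h : ∀ᵐ x : ℝ, e x - f x = c * Complex.exp (Complex.I * k * (x : ℂ))) : c = 0 := by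
  by_contra hc
  have hc0 : 0 < ‖c‖ := norm_pos_iff.2 hc
  have hev : ∀ᶠ x in cocompact ℝ ⊓ ae volume, ‖e x‖ < ‖c‖ / 2 := by
    have := (tendsto_zero_iff_norm_tendsto_zero.1 he).eventually (gt_mem_nhds (half_pos hc0))
    exact this
  rw [eventually_inf] at hev
  obtain ⟨s, hs, t, ht, hst⟩ := hev
  obtain ⟨S, hS, hSs⟩ := mem_cocompact.1 hs
  obtain ⟨N, hN0, hN⟩ := hS.isBounded.exists_pos_norm_le
  have hbig : ∀ᵐ x : ℝ, N < |x| → 1 ≤ ‖Complex.exp (Complex.I * k * (x : ℂ))‖ →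
      ‖c‖ / 2 ≤ ‖f x‖ := by
    filter_upwards [h, ht] with x hx hxt hxN h1
    have hxs : x ∈ s := hSs fun hxS => absurd (hN x hxS) (not_le.2 hxN)
    have h2 := hst x ⟨hxs, hxt⟩
    have h3 : ‖c‖ ≤ ‖e x - f x‖ := by
      rw [hx, norm_mul]
      exact le_mul_of_one_le_right hc0.le h1
    have h4 := norm_sub_le (e x) (f x)
    linarith
  have hfin := hf.meas_ge_lt_top two_ne_zero ENNReal.ofNat_ne_top
    (ε := (‖c‖ / 2).toNNReal) (by simpa using hc0)
  have hmem : ∀ x, ‖c‖ / 2 ≤ ‖f x‖ → x ∈ {x | (‖c‖ / 2).toNNReal ≤ ‖f x‖₊} := fun x hx => by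
    change (‖c‖ / 2).toNNReal ≤ ‖f x‖₊
    rw [← NNReal.coe_le_coe, coe_nnnorm, Real.coe_toNNReal _ (by positivity)]
    exact hx
  -- According to the sign of `Im k`, `|e^{ikx}| ≥ 1` on a right or left half line. Far out on it
  -- `|f| ≥ ‖c‖ / 2`, on a set of infinite measure, which `f ∈ L²` forbids.
  rcases le_total k.im 0 with hk | hk
  · have hle : volume (Set.Ioi N) ≤ volume {x | (‖c‖ / 2).toNNReal ≤ ‖f x‖₊} := by
      refine measure_mono_ae ?_
      filter_upwards [hbig] with x hx (hxN : N < x)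
      refine hmem x (hx (hxN.trans_le (le_abs_self x)) ?_)
      rw [norm_exp_I_mul, Real.one_le_exp_iff]
      nlinarith
    rw [Real.volume_Ioi] at hle
    exact absurd hfin (not_lt.2 hle)
  · have hle : volume (Set.Iio (-N)) ≤ volume {x | (‖c‖ / 2).toNNReal ≤ ‖f x‖₊} := by
      refine measure_mono_ae ?_
      filter_upwards [hbig] with x hx (hxN : x < -N)
      refine hmem x (hx (lt_of_lt_of_le (by linarith) (neg_le_abs x)) ?_)
      rw [norm_exp_I_mul, Real.one_le_exp_iff]
      nlinarith
    rw [Real.volume_Iio] at hle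
    exact absurd hfin (not_lt.2 hle)

/-! ### Weighted Lebesgue spaces -/

theorem weight_pos (x : ℝ) : 0 < weight x := by
  rw [weight]; positivity

theorem one_le_weight (x : ℝ) : 1 ≤ weight x := by
  rw [weight]; linarith [abs_nonneg x]

theorem continuous_weight_rpow (t : ℝ) : Continuous fun x => weight x ^ t := by
  refine Continuous.rpow_const ?_ fun x => Or.inl (weight_pos x).ne'
  unfold weight
  fun_prop

theorem memLp_weight_rpow {t Q : ℝ} (hQ : 0 < Q) (htQ : 1 < t * Q) :
    MemLp (fun x => weight x ^ (-t)) (ENNReal.ofReal Q) := by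
  refine memLp_ofReal_of_integrable_rpow (continuous_weight_rpow _).aestronglyMeasurable
    (fun x => (Real.rpow_pos_of_pos (weight_pos x) _).le) hQ ?_
  have := integrable_one_add_norm (E := ℝ) (μ := volume) (r := t * Q) (by simpa using htQ)
  refine this.congr (ae_of_all _ fun x => ?_)
  simp only
  rw [← Real.rpow_mul (weight_pos x).le, neg_mul]
  rfl

theorem memLp_top_weight_rpow {t : ℝ} (ht : 0 ≤ t) : MemLp (fun x => weight x ^ (-t)) ⊤ := by
  refine memLp_top_of_bound (continuous_weight_rpow _).aestronglyMeasurable 1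
    (ae_of_all _ fun x => ?_)
  rw [Real.norm_of_nonneg (Real.rpow_pos_of_pos (weight_pos x) _).le]
  exact Real.rpow_le_one_of_one_le_of_nonpos (one_le_weight x) (by linarith)

/-- The weight `w ^ (-t)`, `t > 1 - 1/p`, maps `L^p` into `L¹ ∩ L^q` for some `1 < q < ∞`. -/
theorem integrable_weight_mul {p : ℝ≥0∞} (hp : 1 < p) {t : ℝ} (ht : 1 - (p⁻¹).toReal < t)
    {f : ℝ → ℂ} (hf : MemLp f p) :
    Integrable (fun x => ((weight x ^ (-t) : ℝ) : ℂ) * f x) ∧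
      ∃ q : ℝ, 1 < q ∧ MemLp (fun x => ((weight x ^ (-t) : ℝ) : ℂ) * f x) (ENNReal.ofReal q) := by
  rcases eq_or_ne p ⊤ with rfl | hpt
  -- For `p = ∞` the weight `w ^ (-t)` itself lies in `L¹` and `L²`, so `q = 2` serves.
  · have ht1 : 1 < t := by simpa using ht
    have h1 : MemLp (fun x => ((weight x ^ (-t) : ℝ) : ℂ)) 1 := by
      simpa using (memLp_weight_rpow (t := t) one_pos (by linarith)).ofReal (K := ℂ)
    have h2 : MemLp (fun x => ((weight x ^ (-t) : ℝ) : ℂ)) (ENNReal.ofReal 2) :=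
      (memLp_weight_rpow (t := t) two_pos (by linarith)).ofReal
    exact ⟨memLp_one_iff_integrable.1 (hf.mul' h1), 2, one_lt_two, hf.mul' h2⟩
  -- For finite `p`, `w ^ (-t)` lies in the dual space, giving `L¹` by Hölder, and it is bounded,
  -- giving `q = p`.
  · set P := p.toReal with hP
    have hpP : p = ENNReal.ofReal P := (ENNReal.ofReal_toReal hpt).symm
    have hP1 : 1 < P := by
      rw [hP, ← ENNReal.toReal_one]
      exact (ENNReal.toReal_lt_toReal ENNReal.one_ne_top hpt).2 hp
    have hpq := Real.HolderConjugate.conjExponent hP1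
    have hinv : 1 - P⁻¹ = (P.conjExponent)⁻¹ := by
      have := hpq.inv_add_inv_eq_one
      linarith
    rw [ENNReal.toReal_inv, ← hP, hinv] at ht
    have hQ0 := hpq.symm.pos
    have htQ : 1 < t * P.conjExponent := by
      rwa [inv_lt_iff_one_lt_mul₀ hQ0] at ht
    have ht0 : 0 ≤ t := le_trans (inv_nonneg.2 hQ0.le) ht.le
    have hconj := hpq.symm.ennrealOfReal
    rw [hpP] at hf
    exact ⟨memLp_one_iff_integrable.1 (hf.mul' (memLp_weight_rpow hQ0 htQ).ofReal), P, hP1,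
      hf.mul' (memLp_top_weight_rpow ht0).ofReal⟩

theorem weight_rpow_cancel (x t : ℝ) : weight x ^ (-t) * weight x ^ t = 1 := by
  rw [← Real.rpow_add (weight_pos x), neg_add_cancel, Real.rpow_zero]

theorem MemWeightedLp.integrable_ofReal {p : ℝ≥0∞} (hp : 1 < p) {s : ℝ}
    (hs : 1 - (p⁻¹).toReal < s) {u : ℝ → ℝ} (hu : MemWeightedLp p s u) :
    ∃ q : ℝ, 1 < q ∧ MemLp (fun x => (u x : ℂ)) (ENNReal.ofReal q) := by
  obtain ⟨-, q, hq, h⟩ := integrable_weight_mul hp hs (MemLp.ofReal (K := ℂ) hu)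
  refine ⟨q, hq, h.ae_eq (ae_of_all _ fun x => ?_)⟩
  simp only [smul_eq_mul]
  rw [← RCLike.ofReal_eq_complex_ofReal, RCLike.ofReal_eq_complex_ofReal, Complex.ofReal_mul,
    ← mul_assoc, ← Complex.ofReal_mul, weight_rpow_cancel]
  simp

/-- Distribute the weights as `u m = w^{-s₁} (w^s u) (w^{-(s - s₁)} m)`: the last factor is bounded,
and `s₁ > 1 - 1/p` is what the first one needs. -/
theorem MemWeightedLp.integrable_mul {p : ℝ≥0∞} (hp : 1 < p) {s s₁ : ℝ}
    (hs₁ : 1 - (p⁻¹).toReal < s₁) {u : ℝ → ℝ} (hu : MemWeightedLp p s u) {m : ℝ → ℂ}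
    (hm : MemWeightedLp ⊤ (-(s - s₁)) m) :
    Integrable (fun x => (u x : ℂ) * m x) ∧
      ∃ q : ℝ, 1 < q ∧ MemLp (fun x => (u x : ℂ) * m x) (ENNReal.ofReal q) := by
  have hum : MemLp (fun x => ((weight x ^ s * u x : ℝ) : ℂ) * (weight x ^ (-(s - s₁)) • m x)) p :=
    MemLp.mul' (p := p) (q := ⊤) hm (MemLp.ofReal (K := ℂ) hu)
  have heq : ∀ x, ((weight x ^ (-s₁) : ℝ) : ℂ) *
      (((weight x ^ s * u x : ℝ) : ℂ) * (weight x ^ (-(s - s₁)) • m x)) = (u x : ℂ) * m x :=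
    fun x => by
    have h1 : weight x ^ (-s₁) * weight x ^ s * weight x ^ (-(s - s₁)) = 1 := by
      rw [← Real.rpow_add (weight_pos x), ← Real.rpow_add (weight_pos x)]
      ring_nf
      exact Real.rpow_zero _
    have h2 : ((weight x ^ (-s₁) : ℝ) : ℂ) * ((weight x ^ s : ℝ) : ℂ) *
        ((weight x ^ (-(s - s₁)) : ℝ) : ℂ) = 1 := by exact_mod_cast h1
    rw [Complex.real_smul, Complex.ofReal_mul]
    linear_combination ((u x : ℂ) * m x) * h2
  have := integrable_weight_mul hp hs₁ hum
  simpa only [heq] using this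

theorem MemWeightedLp.locallyIntegrable {t : ℝ} {m : ℝ → ℂ} (hm : MemWeightedLp ⊤ t m) :
    LocallyIntegrable m := by
  have h : LocallyIntegrable fun x => (weight x ^ t) • m x := MemLp.locallyIntegrable hm le_top
  have h2 := h.continuous_smul (continuous_weight_rpow (-t))
  refine h2.congr (ae_of_all _ fun x => ?_)
  simp only [smul_smul, weight_rpow_cancel, one_smul]

/-! ### Eigenfunctions and Jost functions -/

theorem memLp_two_kernelG_conv {k : ℂ} (hk : k ∉ nonnegRay) {g : ℝ → ℂ} (hg : Integrable g) :
    MemLp (fun x => ∫ y, kernelG k (x - y) * g y) 2 := by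
  have := memLp_conv one_lt_two (memLp_kernelG hk one_lt_two) hg
  simpa using this

theorem IsEigenfunction.memHardy_top {u : ℝ → ℝ} {l : ℝ} {φ : ℝ → ℂ} (hl : l < 0)
    (hφ : IsEigenfunction u l φ) {q : ℝ} (hq : 1 < q)
    (hu : MemLp (fun x => (u x : ℂ)) (ENNReal.ofReal q)) : MemHardy ⊤ φ := by
  obtain ⟨hH, -, hg, hL⟩ := hφ
  have hk : (l : ℂ) ∉ nonnegRay := by
    simpa using neg_notMem_nonnegRay (neg_pos.2 hl)
  obtain ⟨B, C, hB, hBC⟩ := norm_kernelG_le_majorant hk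
  have hlocG := locallyIntegrable_conv hB (aestronglyMeasurable_kernelG hk) hBC hg
  obtain ⟨c, hc⟩ := hL.exists_eq_const_mul_exp (k := l) (a := 0) (ω := 0)
    (hH.1.locallyIntegrable one_le_two) hlocG (fun ψ => integral_kernelG_conv_testOp hk hg ψ)
    (fun x => by simp)
  simp only [zero_mul, sub_zero] at hc
  -- Here `c e^{ilx}` is a difference of two `L²` functions, so no term vanishing at infinity is
  -- needed.
  have hc0 : c = 0 := const_eq_zero_of_memLp (e := fun _ => 0)
    ((memLp_two_kernelG_conv hk hg).sub hH.1) tendsto_const_nhds (hc.mono fun x hx => by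
      rw [← hx, Pi.sub_apply]; ring)
  have hφG : ∀ᵐ x, φ x = ∫ y, kernelG l (x - y) * ((u y : ℂ) * φ y) := hc.mono fun x hx => by
    rw [hc0, zero_mul] at hx
    exact sub_eq_zero.1 hx
  have hq0 : 0 < q := by linarith
  -- Any `r` strictly between `1` and `q` would do. Then `1/Q = 1/r - 1/q` lies in `(0, 1)`, so
  -- Young's inequality gives `φ ∈ L^Q`, and Hölder puts `u φ` in `L^r`.
  set r := (1 + q) / 2 with hr
  have hr1 : 1 < r := by rw [hr]; linarith
  have hrq : r < q := by rw [hr]; linarith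
  set Q := (r⁻¹ - q⁻¹)⁻¹ with hQ
  have hd0 : 0 < r⁻¹ - q⁻¹ := sub_pos.2 (inv_strictAnti₀ (by linarith) hrq)
  have hd1 : r⁻¹ - q⁻¹ < 1 := by
    have := inv_lt_one_of_one_lt₀ hr1
    have := inv_pos.2 hq0
    linarith
  have hQ1 : 1 < Q := (one_lt_inv₀ hd0).2 hd1
  have hφQ : MemLp φ (ENNReal.ofReal Q) :=
    (memLp_conv hQ1 (memLp_kernelG hk hQ1) hg).ae_eq (hφG.mono fun x hx => hx.symm)
  have htr : Real.HolderTriple q Q r := ⟨by rw [hQ, inv_inv]; ring, hq0, by linarith⟩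
  have := htr.ennrealOfReal
  obtain ⟨G, hG, hGeq⟩ := exists_uniformHardy_kernelG_conv hk hg hr1 (hφQ.mul' hu)
  exact hG.memHardy_top (hφG.mono fun x hx => by rw [hx, hGeq])

/-- The differential problem reduces to the integral equation: `m - 1 - G_k * (u m)` is a multiple
of `e^{ikx}`, and it must vanish because `m - 1` tends to zero and the convolution is in `L²`. -/
theorem memHardy_top_of_off_ray {u : ℝ → ℝ} {k : ℂ} {m : ℝ → ℂ} (hk : k ∉ nonnegRay)
    (hm : LocallyIntegrable m) (hg : Integrable fun x => (u x : ℂ) * m x) {q : ℝ} (hq : 1 < q)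
    (hgq : MemLp (fun x => (u x : ℂ) * m x) (ENNReal.ofReal q))
    (h : JostOneDiff u k m ∨ JostOneInt u k m) : MemHardy ⊤ m := by
  obtain ⟨G, hG, hGeq⟩ := exists_uniformHardy_kernelG_conv hk hg hq hgq
  have hint : JostOneInt u k m := by
    refine h.elim (fun h => ?_) id
    obtain ⟨B, C, hB, hBC⟩ := norm_kernelG_le_majorant hk
    obtain ⟨c, hc⟩ := h.1.exists_eq_const_mul_exp (k := k) (a := 1) (ω := 0) hm
      (locallyIntegrable_conv hB (aestronglyMeasurable_kernelG hk) hBC hg)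
      (fun ψ => integral_kernelG_conv_testOp hk hg ψ) (fun x => by simp; ring)
    simp only [Complex.ofReal_zero, mul_zero, zero_mul, Complex.exp_zero, mul_one] at hc
    have hc0 := const_eq_zero_of_memLp (memLp_two_kernelG_conv hk hg) h.2 hc
    refine hc.mono fun x hx => ?_
    rw [hc0, zero_mul] at hx
    rw [convU]
    linear_combination hx
  refine ((uniformHardy_const 1).add hG).memHardy_top (hint.mono fun x hx => ?_)
  rw [hx, convU, hGeq]

/-- Functions differing from `G_{l ± 0i} * (u m)` by `a e^{iωx}`, or solving the corresponding
differential equation, are in `H^{∞,+}`. -/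
theorem memHardy_top_of_bdry {u : ℝ → ℝ} {l ω : ℝ} {a : ℂ} {m h : ℝ → ℂ} (hl : 0 < l)
    (hω : 0 ≤ ω) (hm : LocallyIntegrable m) (hg : Integrable fun x => (u x : ℂ) * m x) {q : ℝ}
    (hq : 1 < q) (hgq : MemLp (fun x => (u x : ℂ) * m x) (ENNReal.ofReal q))
    (hh : ∀ x : ℝ, h x =
      l * m x - (l - ω) * (a * Complex.exp (Complex.I * (ω : ℂ) * (x : ℂ)))) (σ : Side)
    (hor : SolvesLax u m h ∨ ∀ᵐ x : ℝ, m x =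
      a * Complex.exp (Complex.I * (ω : ℂ) * (x : ℂ)) + convU (kernelGBdry l σ) u m x) :
    MemHardy ⊤ m := by
  rcases hor with hL | hI
  -- Comparison with the upper kernel serves both signs: the resulting multiple of `e^{ilx}` need
  -- not vanish, since it belongs to the class itself.
  · obtain ⟨hfm, ⟨M, hM⟩, hsol⟩ := kernelGBdry_above_spec hl hg hq hgq
    obtain ⟨G, hG, hGeq⟩ := exists_uniformHardy_kernelGBdry_conv hl hg hq hgq Side.above
    obtain ⟨c, hc⟩ := hL.exists_eq_const_mul_exp hm
      (locallyIntegrable_of_bound hfm (ae_of_all _ hM)) hsol hh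
    refine ((((uniformHardy_exp hω).const_mul a).add hG).add
      ((uniformHardy_exp hl.le).const_mul c)).memHardy_top ?_
    filter_upwards [hc, hGeq] with x hx hx'
    rw [← hx', ← hx]
    ring
  · obtain ⟨G, hG, hGeq⟩ := exists_uniformHardy_kernelGBdry_conv hl hg hq hgq σ
    refine (((uniformHardy_exp hω).const_mul a).add hG).memHardy_top ?_
    filter_upwards [hI, hGeq] with x hx hx'
    rw [hx, ← hx', convU]

end BenjaminOno

open BenjaminOno in
theorem lemma7p1 (p : ℝ≥0∞) (hp : 1 < p) (s s₁ : ℝ)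
    (hs₁ : 1 - (p⁻¹).toReal < s₁) (hs : s₁ < s)
    (u : ℝ → ℝ) (hu : BenjaminOno.MemWeightedLp p s u) :
    (∀ (l : ℝ) (φ : ℝ → ℂ), l < 0 → BenjaminOno.IsEigenfunction u l φ →
      BenjaminOno.MemHardy ⊤ φ) ∧
    (∀ (k : ℂ) (m : ℝ → ℂ), k ∉ BenjaminOno.nonnegRay →
      BenjaminOno.MemWeightedLp ⊤ (-(s - s₁)) m →
      (BenjaminOno.JostOneDiff u k m ∨ BenjaminOno.JostOneInt u k m) →
      BenjaminOno.MemHardy ⊤ m) ∧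
    (∀ (l : ℝ) (σ : BenjaminOno.Side) (m : ℝ → ℂ), 0 < l →
      BenjaminOno.MemWeightedLp ⊤ (-(s - s₁)) m →
      (BenjaminOno.JostOneBdryDiff u l σ m ∨ BenjaminOno.JostOneBdryInt u l σ m) →
      BenjaminOno.MemHardy ⊤ m) ∧
    (∀ (l : ℝ) (σ : BenjaminOno.Side) (m : ℝ → ℂ), 0 < l →
      BenjaminOno.MemWeightedLp ⊤ (-(s - s₁)) m →
      (BenjaminOno.JostExpDiff u l σ m ∨ BenjaminOno.JostExpInt u l σ m) →
      BenjaminOno.MemHardy ⊤ m) := by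
  refine ⟨fun l φ hl hφ => ?_, fun k m hk hm h => ?_, fun l σ m hl hm h => ?_,
    fun l σ m hl hm h => ?_⟩
  · obtain ⟨q, hq, hq'⟩ := hu.integrable_ofReal hp (hs₁.trans hs)
    exact hφ.memHardy_top hl hq hq'
  · obtain ⟨hg, q, hq, hgq⟩ := hu.integrable_mul hp hs₁ hm
    exact memHardy_top_of_off_ray hk hm.locallyIntegrable hg hq hgq h
  · obtain ⟨hg, q, hq, hgq⟩ := hu.integrable_mul hp hs₁ hm
    -- With `ω = 0` the exponential is the constant `1`.
    exact memHardy_top_of_bdry (a := 1) (ω := 0) hl le_rfl hm.locallyIntegrable hg hq hgq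
      (h := fun x => (l : ℂ) * (m x - 1)) (fun x => by simp; ring) σ
      (h.imp (fun h => h.1) fun h => h.mono fun x hx => by simpa using hx)
  · obtain ⟨hg, q, hq, hgq⟩ := hu.integrable_mul hp hs₁ hm
    -- With `ω = l` the inhomogeneous term in the differential equation disappears.
    exact memHardy_top_of_bdry (a := 1) (ω := l) hl hl.le hm.locallyIntegrable hg hq hgq
      (h := fun x => (l : ℂ) * m x) (fun x => by simp) σ
      (h.imp (fun h => h.1) fun h => h.mono fun x hx => by simpa using hx)
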